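/- Let $(M,g)$ be a compact connected smooth Riemannian manifold (without boundary), $A$ a real symmetric $k\times k$ matrix, and $\phi_1,\dots,\phi_k:M\to\mathbb C$ smooth functions, none of which vanishes identically. Let $\tau$ denote the Laplace–Beltrami operator of $(M,g)$ and let $\kappa(\phi,\psi)=g(\nabla\phi,\nabla\psi)$, where $g$ is extended complex bilinearly. Call $\{\phi_1,\dots,\phi_k\}$ a $(\lambda_i,B_{ij})$-eigenfamily if $\tau(\phi_i)=\lambda_i\phi_i$ and $\kappa(\phi_i,\phi_j)=B_{ij}\,\phi_i\phi_j$ for all $i,j$, and call it reduced if the matrix $B=(B_{ij})$ is non-degenerate. For $A$ positive definite let $(T^k,A^{-1})$ denote the torus $T^k=(S^1)^k$ with the flat metric $\sum_{i,j}(A^{-1})_{ij}\,dt_i\,dt_j$ in the angle coordinates $(e^{it_1},\dots,e^{it_k})$. The following are equivalent: 1. $\{\phi_1,\dots,\phi_k\}$ is a reduced $(-A_{ii},-A_{ij})$-eigenfamily. 2. $A$ is positive definite, and for every $x_0\in M$ the map $$\pi:(M,g)\to(T^k,A^{-1}),\qquad x\mapsto\Big(\frac{\phi_1(x)}{|\phi_1(x_0)|},\dots,\frac{\phi_k(x)}{|\phi_k(x_0)|}\Big)$$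 is well defined (that is, $\phi_i(x_0)\neq0$ and $|\phi_i(x)|=|\phi_i(x_0)|$ for all $i$ and $x$) and is a harmonic Riemannian submersion, i.e. a smooth map with vanishing tension field whose differential at each point is surjective and is isometric on the orthogonal complement of its kernel. Moreover, in this case $\pi$ maps $M$ onto $T^k$ for every $x_0\in M$. -/

import Mathlib

open scoped Manifold ContDiff

namespace EigenTorus

noncomputable section

/-! ### Riemannian manifolds in local coordinates -/

/-- A smooth Riemannian metric on the manifold `M` modelled on `ℝᵐ`. -/
abbrev SmoothMetric (m : ℕ) (M : Type*) [TopologicalSpace M]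
    [ChartedSpace (EuclideanSpace ℝ (Fin m)) M] [IsManifold (𝓡 m) ∞ M] :=
  Bundle.ContMDiffRiemannianMetric (𝓡 m) ∞ (EuclideanSpace ℝ (Fin m))
    (fun x : M => TangentSpace (𝓡 m) x)

/-- The `i`-th partial derivative of a function on `ℝᵐ`. -/
def partialDeriv {m : ℕ} {F : Type*} [NormedAddCommGroup F] [NormedSpace ℝ F]
    (i : Fin m) (u : EuclideanSpace ℝ (Fin m) → F) (y : EuclideanSpace ℝ (Fin m)) : F :=
  fderiv ℝ u y (EuclideanSpace.single i 1)

section Coordinates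

variable {m : ℕ} {M : Type*} [TopologicalSpace M]
  [ChartedSpace (EuclideanSpace ℝ (Fin m)) M] [IsManifold (𝓡 m) ∞ M]

/-- The `i`-th coordinate vector field `∂/∂xᵢ` of the preferred chart around `x`, at the point
with coordinates `y`. -/
def coordVector (x : M) (y : EuclideanSpace ℝ (Fin m)) (i : Fin m) :
    TangentSpace (𝓡 m) ((extChartAt (𝓡 m) x).symm y) :=
  mfderiv 𝓘(ℝ, EuclideanSpace ℝ (Fin m)) (𝓡 m) (extChartAt (𝓡 m) x).symm y
    (EuclideanSpace.single i (1 : ℝ) : EuclideanSpace ℝ (Fin m))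

/-- The coefficients `gᵢⱼ = g(∂/∂xᵢ, ∂/∂xⱼ)` of the metric in the preferred chart around `x`,
as functions of the coordinates `y`. -/
def coordMetric (g : SmoothMetric m M) (x : M) (y : EuclideanSpace ℝ (Fin m)) :
    Matrix (Fin m) (Fin m) ℝ :=
  Matrix.of fun i j =>
    g.inner ((extChartAt (𝓡 m) x).symm y) (coordVector x y i) (coordVector x y j)

/-- A function read in the preferred chart around `x`. -/
def coordFun {F : Type*} (x : M) (f : M → F) : EuclideanSpace ℝ (Fin m) → F :=
  fun y => f ((extChartAt (𝓡 m) x).symm y)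

end Coordinates

/-- The coordinate expression
`1/√|G| ∑_{i,j} ∂_j (G^{ij} √|G| ∂_i u)` of the Laplace-Beltrami operator of the metric with
coefficients `G`. -/
def coordLaplacian {m : ℕ} {F : Type*} [NormedAddCommGroup F] [NormedSpace ℝ F]
    (G : EuclideanSpace ℝ (Fin m) → Matrix (Fin m) (Fin m) ℝ)
    (u : EuclideanSpace ℝ (Fin m) → F) (y : EuclideanSpace ℝ (Fin m)) : F :=
  (√(G y).det)⁻¹ • ∑ i, ∑ j,
    partialDeriv j (fun z => ((G z)⁻¹ i j * √(G z).det) • partialDeriv i u z) y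

/-- The Christoffel symbols
`Γ^c_{ab} = ½ ∑_d G^{cd} (∂_a G_{bd} + ∂_b G_{ad} - ∂_d G_{ab})` of the Levi-Civita connection of the
metric with coefficients `G`. -/
def christoffel {n : ℕ} (G : EuclideanSpace ℝ (Fin n) → Matrix (Fin n) (Fin n) ℝ)
    (y : EuclideanSpace ℝ (Fin n)) (c a b : Fin n) : ℝ :=
  (1 / 2) * ∑ d, (G y)⁻¹ c d *
    (partialDeriv a (fun z => G z b d) y + partialDeriv b (fun z => G z a d) y
      - partialDeriv d (fun z => G z a b) y)

section Operators

variable {m : ℕ} {M : Type*} [TopologicalSpace M]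
  [ChartedSpace (EuclideanSpace ℝ (Fin m)) M] [IsManifold (𝓡 m) ∞ M]

/-- The Laplace-Beltrami operator `τ(φ) = div ∇φ` on complex-valued functions. -/
def laplaceBeltrami (g : SmoothMetric m M) (φ : M → ℂ) (x : M) : ℂ :=
  coordLaplacian (coordMetric g x) (coordFun x φ) (extChartAt (𝓡 m) x x)

/-- The conformality operator `κ(φ, ψ) = g(∇φ, ∇ψ)`, where `g` is extended complex bilinearly:
in coordinates it is `∑_{i,j} g^{ij} ∂_i φ ∂_j ψ`. -/
def conformality (g : SmoothMetric m M) (φ ψ : M → ℂ) (x : M) : ℂ :=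
  ∑ i, ∑ j, (((coordMetric g x (extChartAt (𝓡 m) x x))⁻¹ i j : ℝ) : ℂ)
    * partialDeriv i (coordFun x φ) (extChartAt (𝓡 m) x x)
    * partialDeriv j (coordFun x ψ) (extChartAt (𝓡 m) x x)

/-- The family `φ₁, …, φₖ` is a `(lamᵢ, Bᵢⱼ)`-eigenfamily. -/
def IsEigenfamily {k : ℕ} (g : SmoothMetric m M) (lam : Fin k → ℂ)
    (B : Matrix (Fin k) (Fin k) ℂ) (φ : Fin k → M → ℂ) : Prop :=
  (∀ i j x, conformality g (φ i) (φ j) x = B i j * (φ i x * φ j x)) ∧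
    ∀ i x, laplaceBeltrami g (φ i) x = lam i * φ i x

/-- A reduced `(lamᵢ, Bᵢⱼ)`-eigenfamily: the matrix `B` is non-degenerate. -/
def IsReducedEigenfamily {k : ℕ} (g : SmoothMetric m M) (lam : Fin k → ℂ)
    (B : Matrix (Fin k) (Fin k) ℂ) (φ : Fin k → M → ℂ) : Prop :=
  IsEigenfamily g lam B φ ∧ B.Nondegenerate

variable {n : ℕ} {N : Type*} [TopologicalSpace N]
  [ChartedSpace (EuclideanSpace ℝ (Fin n)) N] [IsManifold (𝓡 n) ∞ N]

/-- The map `f` read in the preferred charts around `x` and `f x`. -/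
def coordMap (f : M → N) (x : M) : EuclideanSpace ℝ (Fin m) → EuclideanSpace ℝ (Fin n) :=
  fun y => extChartAt (𝓡 n) (f x) (f ((extChartAt (𝓡 m) x).symm y))

/-- The tension field `tr ∇df` of a map `f : (M, g) → (N, h)` of Riemannian manifolds, through its
components in the preferred charts around `x` and `f x`:
`τ(f)^c = τ(f^c) + ∑_{i,j} ∑_{a,b} g^{ij} Γ^c_{ab}(f) ∂_i f^a ∂_j f^b`, with `Γ` the Christoffel symbols of `h`. -/
def tensionField (g : SmoothMetric m M) (h : SmoothMetric n N) (f : M → N) (x : M)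
    (c : Fin n) : ℝ :=
  coordLaplacian (coordMetric g x) (fun y => coordMap f x y c) (extChartAt (𝓡 m) x x)
    + ∑ i, ∑ j, ∑ a, ∑ b, (coordMetric g x (extChartAt (𝓡 m) x x))⁻¹ i j
      * christoffel (coordMetric h (f x)) (extChartAt (𝓡 n) (f x) (f x)) c a b
      * partialDeriv i (fun y => coordMap f x y a) (extChartAt (𝓡 m) x x)
      * partialDeriv j (fun y => coordMap f x y b) (extChartAt (𝓡 m) x x)

/-- A harmonic map: a smooth map with vanishing tension field. -/
def IsHarmonicMap (g : SmoothMetric m M) (h : SmoothMetric n N) (f : M → N) : Prop :=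
  ContMDiff (𝓡 m) (𝓡 n) ∞ f ∧ ∀ x c, tensionField g h f x c = 0

/-- A Riemannian submersion: a smooth map whose differentials are surjective, and isometric on
the orthogonal complements of their kernels. -/
structure IsRiemannianSubmersion (g : SmoothMetric m M) (h : SmoothMetric n N)
    (f : M → N) : Prop where
  contMDiff : ContMDiff (𝓡 m) (𝓡 n) ∞ f
  surjective_mfderiv : ∀ x, Function.Surjective (mfderiv (𝓡 m) (𝓡 n) f x)
  isometry_horizontal : ∀ (x : M) (v w : TangentSpace (𝓡 m) x),
    (∀ u : TangentSpace (𝓡 m) x, mfderiv (𝓡 m) (𝓡 n) f x u = 0 → g.inner x u v = 0) →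
    (∀ u : TangentSpace (𝓡 m) x, mfderiv (𝓡 m) (𝓡 n) f x u = 0 → g.inner x u w = 0) →
    h.inner (f x) (mfderiv (𝓡 m) (𝓡 n) f x v) (mfderiv (𝓡 m) (𝓡 n) f x w) = g.inner x v w

end Operators

/-! ### The flat torus -/

/-- The torus `Tᵏ = (S¹)ᵏ`. -/
def Torus (k : ℕ) : Type := Fin k → Circle

namespace Torus

variable {k : ℕ}

instance : TopologicalSpace (Torus k) := inferInstanceAs (TopologicalSpace (Fin k → Circle))

/-- The chart of the torus around `p` given by the angles `t ∈ (-π, π)ᵏ`, where `t` corresponds to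
the point `(p₁ e^{i t₁}, …, pₖ e^{i tₖ})`. -/
def angleChart (p : Torus k) : OpenPartialHomeomorph (Torus k) (EuclideanSpace ℝ (Fin k)) where
  toFun q := WithLp.toLp 2 fun i => Complex.arg ((q i / p i : Circle) : ℂ)
  invFun t := fun i => p i * Circle.exp (t i)
  source := {q | ∀ i, ((q i / p i : Circle) : ℂ) ∈ Complex.slitPlane}
  target := {t | ∀ i, t i ∈ Set.Ioo (-Real.pi) Real.pi}
  map_source' q hq i := by
    have h := Complex.mem_slitPlane_iff_arg.1 (hq i)
    exact ⟨Complex.neg_pi_lt_arg _, lt_of_le_of_ne (Complex.arg_le_pi _) h.1⟩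
  map_target' t ht i := by
    rw [mul_div_cancel_left, Complex.mem_slitPlane_iff_arg,
      Circle.arg_exp (ht i).1 (ht i).2.le]
    exact ⟨(ht i).2.ne, Circle.coe_ne_zero _⟩
  left_inv' q _ := by
    funext i
    simp only [Circle.exp_arg, mul_div_cancel]
  right_inv' t ht := by
    ext i
    simp only [mul_div_cancel_left]
    exact Circle.arg_exp (ht i).1 (ht i).2.le
  open_source := by
    have : {q : Torus k | ∀ i, ((q i / p i : Circle) : ℂ) ∈ Complex.slitPlane}
        = ⋂ i, (fun q : Fin k → Circle => ((q i / p i : Circle) : ℂ)) ⁻¹' Complex.slitPlane := by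
      ext q
      exact ⟨fun h => Set.mem_iInter.2 h, fun h => Set.mem_iInter.1 h⟩
    rw [this]
    exact isOpen_iInter_of_finite fun i => Complex.isOpen_slitPlane.preimage
      (continuous_subtype_val.comp (by fun_prop))
  open_target := by
    have : {t : EuclideanSpace ℝ (Fin k) | ∀ i, t i ∈ Set.Ioo (-Real.pi) Real.pi}
        = ⋂ i, (fun t : EuclideanSpace ℝ (Fin k) => t i) ⁻¹' Set.Ioo (-Real.pi) Real.pi := by
      ext q
      rw [Set.mem_iInter]
      rfl
    rw [this]
    exact isOpen_iInter_of_finite fun i => isOpen_Ioo.preimage (by fun_prop)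
  continuousOn_toFun := by
    refine (PiLp.continuous_toLp 2 _).comp_continuousOn (continuousOn_pi.2 fun i q hq => ?_)
    have h1 : Continuous (fun q : Fin k → Circle => ((q i / p i : Circle) : ℂ)) :=
      continuous_subtype_val.comp (by fun_prop)
    exact (ContinuousAt.comp (f := fun q : Fin k → Circle => ((q i / p i : Circle) : ℂ))
      (Complex.continuousAt_arg (hq i)) h1.continuousAt).continuousWithinAt
  continuousOn_invFun := by
    refine Continuous.continuousOn (continuous_pi fun i => ?_)
    fun_prop

instance : ChartedSpace (EuclideanSpace ℝ (Fin k)) (Torus k) where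
  atlas := Set.range angleChart
  chartAt := angleChart
  mem_chart_source p i := by
    rw [div_self']
    exact Complex.one_mem_slitPlane
  chart_mem_atlas p := Set.mem_range_self p

/-- The changes of angle coordinates are locally translations. -/
lemma angleChart_change (p p' : Torus k) (t : EuclideanSpace ℝ (Fin k))
    (ht : (angleChart p).symm t ∈ (angleChart p').source) :
    (fun s => angleChart p' ((angleChart p).symm s)) =ᶠ[nhds t]
      fun s => s + (angleChart p' ((angleChart p).symm t) - t) := by
  set c := angleChart p' ((angleChart p).symm t) - t with hc
  have h2 : t + c ∈ (angleChart p').target := by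
    rw [hc, add_sub_cancel]
    exact (angleChart p').map_source ht
  have h3 : ∀ᶠ s in nhds t, s + c ∈ (angleChart p').target :=
    (continuous_add_const c).continuousAt.eventually_mem
      ((angleChart p').open_target.mem_nhds h2)
  have h4 : (angleChart p').symm (t + c) = (angleChart p).symm t := by
    rw [hc, add_sub_cancel]
    exact (angleChart p').left_inv ht
  filter_upwards [h3] with s hs
  have h5 : (angleChart p').symm (s + c) = (angleChart p).symm s := by
    funext i
    have h6 : p' i * Circle.exp (t i + c i) = p i * Circle.exp (t i) := congrFun h4 i
    change p' i * Circle.exp (s i + c i) = p i * Circle.exp (s i)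
    rw [Circle.exp_add, ← mul_assoc] at h6
    have h7 : s i = t i + (s i - t i) := by ring
    rw [h7, add_right_comm, Circle.exp_add, Circle.exp_add, Circle.exp_add, ← mul_assoc,
      ← mul_assoc, ← mul_assoc]
    rw [← h6]
  rw [← h5]
  exact (angleChart p').right_inv hs

instance : IsManifold (𝓡 k) ∞ (Torus k) := by
  refine isManifold_of_contDiffOn _ _ _ ?_
  rintro _ _ ⟨p, rfl⟩ ⟨p', rfl⟩ t ht
  have h1 : (angleChart p).symm t ∈ (angleChart p').source := by
    simpa using ht.1.2
  refine ContDiffAt.contDiffWithinAt ?_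
  refine ContDiffAt.congr_of_eventuallyEq ?_ (angleChart_change p p' t h1)
  fun_prop

/-- The bilinear form `(v, w) ↦ ∑ᵢⱼ Bᵢⱼ vᵢ wⱼ`. -/
def matrixForm (B : Matrix (Fin k) (Fin k) ℝ) :
    EuclideanSpace ℝ (Fin k) →L[ℝ] EuclideanSpace ℝ (Fin k) →L[ℝ] ℝ :=
  ∑ i, ∑ j, B i j • (ContinuousLinearMap.smulRight (EuclideanSpace.proj i)
    (EuclideanSpace.proj j : EuclideanSpace ℝ (Fin k) →L[ℝ] ℝ))

lemma matrixForm_apply (B : Matrix (Fin k) (Fin k) ℝ) (v w : EuclideanSpace ℝ (Fin k)) :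
    matrixForm B v w = ∑ i, ∑ j, B i j * (v i * w j) := by
  simp [matrixForm]

lemma matrixForm_pos {B : Matrix (Fin k) (Fin k) ℝ} (hB : B.PosDef)
    {v : EuclideanSpace ℝ (Fin k)} (hv : v ≠ 0) : 0 < matrixForm B v v := by
  have h0 : (v.ofLp : Fin k → ℝ) ≠ 0 := fun h => hv (by ext i; exact congrFun h i)
  have h := hB.dotProduct_mulVec_pos h0
  rw [matrixForm_apply]
  have h1 : ∑ i, ∑ j, B i j * (v i * v j) = star v.ofLp ⬝ᵥ B.mulVec v.ofLp := by
    simp only [dotProduct, Matrix.mulVec, Finset.mul_sum, Pi.star_apply, star_trivial]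
    exact Finset.sum_congr rfl fun i _ => Finset.sum_congr rfl fun j _ => by ring
  rw [h1]
  exact h

lemma matrixForm_isVonNBounded {B : Matrix (Fin k) (Fin k) ℝ} (hB : B.PosDef) :
    Bornology.IsVonNBounded ℝ {v : EuclideanSpace ℝ (Fin k) | matrixForm B v v < 1} := by
  rw [NormedSpace.isVonNBounded_iff, isBounded_iff_forall_norm_le]
  have hc : Continuous fun v : EuclideanSpace ℝ (Fin k) => matrixForm B v v := by fun_prop
  rcases (Metric.sphere (0 : EuclideanSpace ℝ (Fin k)) 1).eq_empty_or_nonempty with h | h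
  · refine ⟨0, fun v _ => ?_⟩
    by_contra! hv
    have h1 : ‖v‖⁻¹ • v ∈ Metric.sphere (0 : EuclideanSpace ℝ (Fin k)) 1 := by
      simp [norm_smul, hv.ne']
    simp [h] at h1
  · obtain ⟨w, hw, hmin⟩ := (isCompact_sphere (0 : EuclideanSpace ℝ (Fin k)) 1).exists_isMinOn h
      hc.continuousOn
    have hw0 : w ≠ 0 := by
      rintro rfl
      simp at hw
    have hpos := matrixForm_pos hB hw0
    set c := matrixForm B w w with hcdef
    refine ⟨√c⁻¹, fun v hv => ?_⟩
    rcases eq_or_ne v 0 with rfl | hv0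
    · simp
    have hn : 0 < ‖v‖ := norm_pos_iff.2 hv0
    have h1 : ‖v‖⁻¹ • v ∈ Metric.sphere (0 : EuclideanSpace ℝ (Fin k)) 1 := by
      simp [norm_smul, hn.ne']
    have h2 : c ≤ matrixForm B (‖v‖⁻¹ • v) (‖v‖⁻¹ • v) := hmin h1
    simp only [map_smul, smul_apply, smul_eq_mul] at h2
    have h3 : matrixForm B v v < 1 := hv
    apply Real.le_sqrt_of_sq_le
    rw [← mul_assoc, ← mul_inv, inv_mul_eq_div, le_div_iff₀ (by positivity)] at h2
    rw [← one_div, le_div_iff₀ hpos]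
    nlinarith

/-- The bilinear form `∑ᵢⱼ (A⁻¹)ᵢⱼ dtᵢ dtⱼ` on the tangent space of the torus at `p`, which is
identified with `ℝᵏ` through the angle coordinates `t` around `p`. -/
def flatInner (A : Matrix (Fin k) (Fin k) ℝ) (p : Torus k) :
    TangentSpace (𝓡 k) p →L[ℝ] TangentSpace (𝓡 k) p →L[ℝ] ℝ :=
  matrixForm A⁻¹

/-- The derivatives of the changes of angle coordinates are the identity. -/
lemma symmL_trivializationAt {p q : Torus k} (h : q ∈ (angleChart p).source) :
    (trivializationAt (EuclideanSpace ℝ (Fin k)) (TangentSpace (𝓡 k) : Torus k → Type _) p).symmL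
      ℝ q = ContinuousLinearMap.id ℝ (EuclideanSpace ℝ (Fin k)) := by
  rw [TangentBundle.symmL_trivializationAt_eq_core h]
  have h1 : (angleChart p).symm (angleChart p q) ∈ (angleChart q).source := by
    rw [(angleChart p).left_inv h]
    exact mem_chart_source (EuclideanSpace ℝ (Fin k)) q
  have h2 := (angleChart_change p q (angleChart p q) h1).fderiv_eq (𝕜 := ℝ)
  rw [fderiv_add_const, fderiv_fun_id] at h2
  rw [tangentBundleCore_coordChange]
  simp only [modelWithCornersSelf_coe, Set.range_id, fderivWithin_univ]
  exact h2

/-- The flat Riemannian metric `A⁻¹` on the torus, for `A` positive definite. -/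
def flatMetric (A : Matrix (Fin k) (Fin k) ℝ) (hA : A.PosDef) : SmoothMetric k (Torus k) where
  inner := flatInner A
  symm _ v w := by
    have h : ∀ i j, A⁻¹ i j = A⁻¹ j i := fun i j => (hA.inv.isHermitian.apply i j).symm
    have h' : ∀ v w : EuclideanSpace ℝ (Fin k), matrixForm A⁻¹ v w = matrixForm A⁻¹ w v := by
      intro v w
      rw [matrixForm_apply, matrixForm_apply, Finset.sum_comm]
      refine Finset.sum_congr rfl fun i _ => Finset.sum_congr rfl fun j _ => ?_
      rw [h j i, mul_comm (v j)]
    exact h' v w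
  pos _ _ hv := matrixForm_pos hA.inv hv
  isVonNBounded _ := matrixForm_isVonNBounded hA.inv
  contMDiff p := by
    rw [Bundle.contMDiffAt_section]
    refine ContMDiffAt.congr_of_eventuallyEq (contMDiffAt_const (c := matrixForm A⁻¹)) ?_
    filter_upwards [(angleChart p).open_source.mem_nhds
      (mem_chart_source (EuclideanSpace ℝ (Fin k)) p)] with q hq
    have h1 := symmL_trivializationAt hq
    ext v w
    simp only [hom_trivializationAt_apply, ContinuousLinearMap.inCoordinates]
    rw [h1]
    have h2 : q ∈ (trivializationAt (EuclideanSpace ℝ (Fin k) →L[ℝ] ℝ)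
        (fun x : Torus k => TangentSpace (𝓡 k) x →L[ℝ] ℝ) p).baseSet := by
      have h3 : q ∈ (chartAt (EuclideanSpace ℝ (Fin k)) p).source := hq
      simpa using h3
    simp only [ContinuousLinearMap.comp_apply, Bundle.Trivialization.continuousLinearMapAt_apply,
      Bundle.Trivialization.coe_linearMapAt_of_mem _ h2]
    simp only [hom_trivializationAt_apply, ContinuousLinearMap.inCoordinates]
    rw [h1]
    simp
    rfl

end Torus

end

end EigenTorus

/-! The crux is that an eigenfunction in the family has constant modulus. Let φ = r + is with τ(φ) =
-λφ and κ(φ, φ) = -λφ², λ real, and put P = |∇r|², Q = |∇s|², R = g(∇r, ∇s). The second equation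
says P - Q = -λ(r² - s²) and R = -λrs. With Cauchy–Schwarz, R² ≤ PQ, this gives (P + Q)² = (P - Q)²
+ 4PQ ≥ λ²(r² + s²)², hence P + Q ≥ λ|φ|². Therefore Δ|φ|² = 2(P + Q) - 2λ|φ|² ≥ 0, and on a compact
connected manifold the strong maximum principle makes |φ|² constant (`norm_eq_of_eigenfunction`,
`eq_of_subharmonic`). No sign of λ is needed.

Each φᵢ then has no zero, and near x it equals φᵢ(x) exp(iθᵢ) with a smooth real angle θᵢ. At x,
κ(φᵢ, φⱼ) = -g(∇θᵢ, ∇θⱼ) φᵢφⱼ and τ(φᵢ) = (iΔθᵢ - |∇θᵢ|²) φᵢ, so the eigenfamily equations amount to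
g(∇θᵢ, ∇θⱼ) = Aᵢⱼ and Δθᵢ = 0 (`isEigenfamily_iff_angle`).

In angle coordinates the θᵢ are the components of π. By linear algebra, a map with Jacobian Θ is a
Riemannian submersion onto the metric A⁻¹ exactly when ΘG⁻¹Θᵀ = A (`surjective_and_isometry_iff`),
which is the first condition. The torus metric has constant coefficients, so the tension field is
(Δθᵢ), which gives the second. Positivity of A is automatic: it is a Gram matrix, hence
semidefinite, and reducedness makes it invertible. In the converse direction the modulus is constant
because π takes values in circles. Surjectivity of π holds because its image is compact and, by the
submersion property, open.

The analytic work lies in the maximum principle, proved in one chart by Hopf's barrier, and in the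
independence of the Laplacian from the chart, proved by Piola's identity; the latter lets a
hypothesis stated at chart centres be used throughout a chart. -/

namespace EigenTorus

noncomputable section

open Filter Topology

local notation "𝔼" m => EuclideanSpace ℝ (Fin m)

/-! ### Coordinate calculus: partial derivatives and the Laplacian -/

section Calculus

variable {m : ℕ} {F F' : Type*} [NormedAddCommGroup F] [NormedSpace ℝ F]
  [NormedAddCommGroup F'] [NormedSpace ℝ F']

lemma partialDeriv_congr {u v : (𝔼 m) → F} {y : 𝔼 m} (h : u =ᶠ[𝓝 y] v) (i : Fin m) :
    partialDeriv i u y = partialDeriv i v y := by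
  rw [partialDeriv, h.fderiv_eq, partialDeriv]

lemma partialDeriv_eventuallyEq {u v : (𝔼 m) → F} {y : 𝔼 m} (h : u =ᶠ[𝓝 y] v) (i : Fin m) :
    partialDeriv i u =ᶠ[𝓝 y] partialDeriv i v := by
  filter_upwards [h.eventually_nhds] with z hz using partialDeriv_congr hz i

lemma contDiffAt_partialDeriv {u : (𝔼 m) → F} {y : 𝔼 m} (h : ContDiffAt ℝ ∞ u y) (i : Fin m) :
    ContDiffAt ℝ ∞ (partialDeriv i u) y :=
  (h.fderiv_right (m := ∞) (by simp)).clm_apply contDiffAt_const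

lemma differentiableAt_of_smooth {u : (𝔼 m) → F} {y : 𝔼 m} (h : ContDiffAt ℝ ∞ u y) :
    DifferentiableAt ℝ u y :=
  h.differentiableAt (by simp)

lemma eventually_smooth {u : (𝔼 m) → F} {y : 𝔼 m} (h : ContDiffAt ℝ ∞ u y) :
    ∀ᶠ z in 𝓝 y, DifferentiableAt ℝ u z := by
  filter_upwards [(h.of_le (m := 1) (by exact_mod_cast le_top)).eventually (by simp)] with z hz
  exact hz.differentiableAt (by simp)

lemma partialDeriv_const (i : Fin m) (c : F) (y : 𝔼 m) :
    partialDeriv i (fun _ => c) y = 0 := by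
  simp [partialDeriv]

lemma partialDeriv_add {u v : (𝔼 m) → F} {y : 𝔼 m} (hu : DifferentiableAt ℝ u y)
    (hv : DifferentiableAt ℝ v y) (i : Fin m) :
    partialDeriv i (fun z => u z + v z) y = partialDeriv i u y + partialDeriv i v y := by
  simp [partialDeriv, fderiv_fun_add hu hv]

lemma partialDeriv_sum {ι : Type*} {s : Finset ι} {u : ι → (𝔼 m) → F} {y : 𝔼 m}
    (hu : ∀ a ∈ s, DifferentiableAt ℝ (u a) y) (i : Fin m) :
    partialDeriv i (fun z => ∑ a ∈ s, u a z) y = ∑ a ∈ s, partialDeriv i (u a) y := by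
  simp [partialDeriv, fderiv_fun_sum hu]

lemma partialDeriv_smul {c : (𝔼 m) → ℝ} {u : (𝔼 m) → F} {y : 𝔼 m} (hc : DifferentiableAt ℝ c y)
    (hu : DifferentiableAt ℝ u y) (i : Fin m) :
    partialDeriv i (fun z => c z • u z) y = c y • partialDeriv i u y + partialDeriv i c y • u y := by
  simp [partialDeriv, fderiv_fun_smul hc hu]

lemma partialDeriv_mul {c u : (𝔼 m) → ℝ} {y : 𝔼 m} (hc : DifferentiableAt ℝ c y)
    (hu : DifferentiableAt ℝ u y) (i : Fin m) :
    partialDeriv i (fun z => c z * u z) y = c y * partialDeriv i u y + partialDeriv i c y * u y :=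
  partialDeriv_smul hc hu i

lemma partialDeriv_clm_comp (l : F →L[ℝ] F') {u : (𝔼 m) → F} {y : 𝔼 m}
    (hu : DifferentiableAt ℝ u y) (i : Fin m) :
    partialDeriv i (fun z => l (u z)) y = l (partialDeriv i u y) := by
  have := (l.hasFDerivAt.comp y hu.hasFDerivAt).fderiv
  simp only [partialDeriv]
  rw [show (fun z => l (u z)) = l ∘ u from rfl, this]
  rfl

lemma fderiv_apply_eq_sum {n : ℕ} (L : (𝔼 n) →L[ℝ] F) (v : 𝔼 n) :
    L v = ∑ a, v a • L (EuclideanSpace.single a 1) := by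
  conv_lhs => rw [← (EuclideanSpace.basisFun (Fin n) ℝ).sum_repr v]
  simp

/-- The chain rule for a real function of one variable composed with a scalar function. -/
lemma partialDeriv_scalar_comp {f : ℝ → F} {u : (𝔼 m) → ℝ} {y : 𝔼 m}
    (hf : DifferentiableAt ℝ f (u y)) (hu : DifferentiableAt ℝ u y) (i : Fin m) :
    partialDeriv i (fun z => f (u z)) y = partialDeriv i u y • deriv f (u y) := by
  have := (hf.hasFDerivAt.comp y hu.hasFDerivAt).fderiv
  simp only [partialDeriv]
  rw [show (fun z => f (u z)) = f ∘ u from rfl, this]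
  simp only [ContinuousLinearMap.comp_apply]
  rw [fderiv_eq_smul_deriv]

/-- The chain rule for a change of coordinates. -/
lemma partialDeriv_comp {n : ℕ} {Φ : (𝔼 m) → 𝔼 n} {u : (𝔼 n) → F} {y : 𝔼 m}
    (hu : DifferentiableAt ℝ u (Φ y)) (hΦ : DifferentiableAt ℝ Φ y) (i : Fin m) :
    partialDeriv i (fun z => u (Φ z)) y
      = ∑ a, partialDeriv i (fun z => Φ z a) y • partialDeriv a u (Φ y) := by
  have := (hu.hasFDerivAt.comp y hΦ.hasFDerivAt).fderiv
  simp only [partialDeriv]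
  rw [show (fun z => u (Φ z)) = u ∘ Φ from rfl, this, ContinuousLinearMap.comp_apply,
    fderiv_apply_eq_sum]
  refine Finset.sum_congr rfl fun a _ => ?_
  congr 1
  exact (partialDeriv_clm_comp (EuclideanSpace.proj a : (𝔼 n) →L[ℝ] ℝ) hΦ i).symm

lemma partialDeriv_comm {u : (𝔼 m) → F} {y : 𝔼 m} (h : ContDiffAt ℝ ∞ u y) (i j : Fin m) :
    partialDeriv i (partialDeriv j u) y = partialDeriv j (partialDeriv i u) y := by
  have h1 : DifferentiableAt ℝ (fderiv ℝ u) y :=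
    (h.fderiv_right (m := ∞) (by simp)).differentiableAt (by simp)
  have h2 : ∀ i j : Fin m, partialDeriv i (partialDeriv j u) y
      = fderiv ℝ (fderiv ℝ u) y (EuclideanSpace.single i 1) (EuclideanSpace.single j 1) := by
    intro i j
    have := fderiv_clm_apply h1 (differentiableAt_const (EuclideanSpace.single j (1 : ℝ)))
    change fderiv ℝ (fun y => fderiv ℝ u y (EuclideanSpace.single j 1)) y
      (EuclideanSpace.single i 1) = _
    rw [this]
    simp
  rw [h2, h2]
  exact (h.isSymmSndFDerivAt (by rw [minSmoothness_of_isRCLikeNormedField]; exact WithTop.coe_le_coe.2 (le_top : (2 : ℕ∞) ≤ ⊤))) _ _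

/-! ### Smoothness of the coefficients -/

lemma contDiffAt_det {ι : Type*} [Fintype ι] [DecidableEq ι] {J : (𝔼 m) → Matrix ι ι ℝ} {y : 𝔼 m}
    (hJ : ∀ i j, ContDiffAt ℝ ∞ (fun z => J z i j) y) :
    ContDiffAt ℝ ∞ (fun z => (J z).det) y := by
  simp only [Matrix.det_apply]
  refine ContDiffAt.sum fun σ _ => ?_
  exact (contDiffAt_prod fun i _ => hJ _ _).const_smul _

lemma contDiffAt_adjugate {ι : Type*} [Fintype ι] [DecidableEq ι] {J : (𝔼 m) → Matrix ι ι ℝ}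
    {y : 𝔼 m} (hJ : ∀ i j, ContDiffAt ℝ ∞ (fun z => J z i j) y) (i j : ι) :
    ContDiffAt ℝ ∞ (fun z => (J z).adjugate i j) y := by
  simp only [Matrix.adjugate_apply]
  refine contDiffAt_det fun a b => ?_
  simp only [Matrix.updateRow_apply]
  split_ifs
  · exact contDiffAt_const
  · exact hJ a b

lemma contDiffAt_matrix_inv {ι : Type*} [Fintype ι] [DecidableEq ι] {J : (𝔼 m) → Matrix ι ι ℝ}
    {y : 𝔼 m} (hJ : ∀ i j, ContDiffAt ℝ ∞ (fun z => J z i j) y) (h0 : (J y).det ≠ 0) (i j : ι) :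
    ContDiffAt ℝ ∞ (fun z => (J z)⁻¹ i j) y := by
  simp only [Matrix.inv_def, Ring.inverse_eq_inv', Matrix.smul_apply, smul_eq_mul]
  exact ((contDiffAt_det hJ).inv h0).mul (contDiffAt_adjugate hJ i j)

variable {G : (𝔼 m) → Matrix (Fin m) (Fin m) ℝ} {y : 𝔼 m}

lemma contDiffAt_sqrt_det (hG : ∀ i j, ContDiffAt ℝ ∞ (fun z => G z i j) y)
    (h0 : 0 < (G y).det) : ContDiffAt ℝ ∞ (fun z => √(G z).det) y :=
  (contDiffAt_det hG).sqrt h0.ne'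

lemma contDiffAt_weight (hG : ∀ i j, ContDiffAt ℝ ∞ (fun z => G z i j) y)
    (h0 : 0 < (G y).det) (i j : Fin m) :
    ContDiffAt ℝ ∞ (fun z => (G z)⁻¹ i j * √(G z).det) y :=
  (contDiffAt_matrix_inv hG h0.ne' i j).mul (contDiffAt_sqrt_det hG h0)

lemma contDiffAt_flux (hG : ∀ i j, ContDiffAt ℝ ∞ (fun z => G z i j) y)
    (h0 : 0 < (G y).det) {u : (𝔼 m) → F} (hu : ContDiffAt ℝ ∞ u y) (i j : Fin m) :
    ContDiffAt ℝ ∞ (fun z => ((G z)⁻¹ i j * √(G z).det) • partialDeriv i u z) y :=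
  (contDiffAt_weight hG h0 i j).smul (contDiffAt_partialDeriv hu i)

lemma contDiffAt_coordLaplacian (hG : ∀ i j, ContDiffAt ℝ ∞ (fun z => G z i j) y)
    (h0 : 0 < (G y).det) {u : (𝔼 m) → F} (hu : ContDiffAt ℝ ∞ u y) :
    ContDiffAt ℝ ∞ (coordLaplacian G u) y := by
  refine ((contDiffAt_sqrt_det hG h0).inv (Real.sqrt_pos.2 h0).ne').smul ?_
  exact ContDiffAt.sum fun i _ => ContDiffAt.sum fun j _ =>
    contDiffAt_partialDeriv (contDiffAt_flux hG h0 hu i j) j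

/-! ### Calculus of the Laplacian -/

/-- The inner product of the gradients of two real functions, in coordinates. -/
def gradInner (G : (𝔼 m) → Matrix (Fin m) (Fin m) ℝ) (u v : (𝔼 m) → ℝ) (y : 𝔼 m) : ℝ :=
  ∑ i, ∑ j, (G y)⁻¹ i j * partialDeriv i u y * partialDeriv j v y

lemma coordLaplacian_congr {G' : (𝔼 m) → Matrix (Fin m) (Fin m) ℝ} {u v : (𝔼 m) → F}
    (hG : G =ᶠ[𝓝 y] G') (h : u =ᶠ[𝓝 y] v) :
    coordLaplacian G u y = coordLaplacian G' v y := by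
  simp only [coordLaplacian]
  rw [hG.self_of_nhds]
  congr 1
  refine Finset.sum_congr rfl fun i _ => Finset.sum_congr rfl fun j _ => partialDeriv_congr ?_ j
  filter_upwards [hG, partialDeriv_eventuallyEq h i] with z hz hz'
  rw [hz, hz']

lemma coordLaplacian_add (hG : ∀ i j, ContDiffAt ℝ ∞ (fun z => G z i j) y)
    (h0 : 0 < (G y).det) {u v : (𝔼 m) → F} (hu : ContDiffAt ℝ ∞ u y) (hv : ContDiffAt ℝ ∞ v y) :
    coordLaplacian G (fun z => u z + v z) y = coordLaplacian G u y + coordLaplacian G v y := by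
  simp only [coordLaplacian]
  rw [← smul_add, ← Finset.sum_add_distrib]
  congr 1
  refine Finset.sum_congr rfl fun i _ => ?_
  rw [← Finset.sum_add_distrib]
  refine Finset.sum_congr rfl fun j _ => ?_
  rw [← partialDeriv_add
    (differentiableAt_of_smooth (contDiffAt_flux hG h0 hu i j))
    (differentiableAt_of_smooth (contDiffAt_flux hG h0 hv i j))]
  refine partialDeriv_congr ?_ j
  filter_upwards [eventually_smooth hu, eventually_smooth hv] with z hz hz'
  rw [partialDeriv_add hz hz', smul_add]

lemma coordLaplacian_clm_comp (hG : ∀ i j, ContDiffAt ℝ ∞ (fun z => G z i j) y)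
    (h0 : 0 < (G y).det) (l : F →L[ℝ] F') {u : (𝔼 m) → F} (hu : ContDiffAt ℝ ∞ u y) :
    coordLaplacian G (fun z => l (u z)) y = l (coordLaplacian G u y) := by
  simp only [coordLaplacian]
  rw [map_smul, map_sum]
  congr 1
  refine Finset.sum_congr rfl fun i _ => ?_
  rw [map_sum]
  refine Finset.sum_congr rfl fun j _ => ?_
  rw [← partialDeriv_clm_comp l
    (differentiableAt_of_smooth (contDiffAt_flux hG h0 hu i j))]
  refine partialDeriv_congr ?_ j
  filter_upwards [eventually_smooth hu] with z hz
  rw [partialDeriv_clm_comp l hz, map_smul]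

/-- The chain rule `Δ(f ∘ u) = f'(u) Δu + f''(u) |∇u|²`. -/
lemma coordLaplacian_scalar_comp (hG : ∀ i j, ContDiffAt ℝ ∞ (fun z => G z i j) y)
    (h0 : 0 < (G y).det) {f : ℝ → F} (hf : ContDiff ℝ ∞ f) {u : (𝔼 m) → ℝ}
    (hu : ContDiffAt ℝ ∞ u y) :
    coordLaplacian G (fun z => f (u z)) y
      = coordLaplacian G u y • deriv f (u y) + gradInner G u u y • deriv (deriv f) (u y) := by
  have hf' : ContDiff ℝ ∞ (deriv f) := hf.deriv'
  have hs : (√(G y).det)⁻¹ * √(G y).det = 1 := inv_mul_cancel₀ (Real.sqrt_pos.2 h0).ne'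
  -- The flux of f ∘ u is f'(u) times the flux of u; the product rule yields one term for each
  -- summand of the formula.
  have key : ∀ i j, partialDeriv j
      (fun z => ((G z)⁻¹ i j * √(G z).det) • partialDeriv i (fun z => f (u z)) z) y
      = partialDeriv j (fun z => ((G z)⁻¹ i j * √(G z).det) • partialDeriv i u z) y
          • deriv f (u y)
        + (√(G y).det * ((G y)⁻¹ i j * partialDeriv i u y * partialDeriv j u y))
          • deriv (deriv f) (u y) := by
    intro i j
    have hw := contDiffAt_flux hG h0 hu i j
    have h1 : (fun z => ((G z)⁻¹ i j * √(G z).det) • partialDeriv i (fun z => f (u z)) z)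
        =ᶠ[𝓝 y] fun z => (((G z)⁻¹ i j * √(G z).det) • partialDeriv i u z) • deriv f (u z) := by
      filter_upwards [eventually_smooth hu] with z hz
      rw [partialDeriv_scalar_comp (hf.differentiable (by simp) _) hz, smul_assoc]
    have h2 : ContDiffAt ℝ ∞ (fun z => deriv f (u z)) y := hf'.contDiffAt.comp y hu
    rw [partialDeriv_congr h1, partialDeriv_smul (differentiableAt_of_smooth hw)
      (differentiableAt_of_smooth h2), partialDeriv_scalar_comp (hf'.differentiable (by simp) _)
      (differentiableAt_of_smooth hu), add_comm, smul_smul]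
    congr 2
    simp only [smul_eq_mul]
    ring
  simp only [coordLaplacian, key, gradInner, Finset.sum_add_distrib, ← Finset.sum_smul,
    ← Finset.mul_sum, smul_add, smul_smul, smul_eq_mul]
  rw [← mul_assoc, hs, one_mul]

end Calculus

/-! ### Hopf's strong maximum principle in a ball -/

section MaximumPrinciple

variable {m : ℕ}

/-- A positive second derivative would make t a local minimum too, so f would be locally constant
and its second derivative zero. -/
lemma deriv_deriv_nonpos_of_isLocalMax {f : ℝ → ℝ} {t : ℝ} (h : IsLocalMax f t)
    (hf : ContinuousAt f t) : deriv (deriv f) t ≤ 0 := by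
  by_contra! hpos
  have hmin := isLocalMin_of_deriv_deriv_pos hpos h.deriv_eq_zero hf
  have hconst : f =ᶠ[𝓝 t] fun _ => f t := by
    filter_upwards [h, hmin] with s h1 h2 using le_antisymm h1 h2
  have := hconst.deriv.deriv_eq
  simp at this
  linarith

/-- The Hessian at a local maximum is negative semidefinite. -/
lemma hessian_nonpos_of_isLocalMax {E : Type*} [NormedAddCommGroup E] [NormedSpace ℝ E]
    {u : E → ℝ} {y : E} (hu : ContDiffAt ℝ ∞ u y) (h : IsLocalMax u y) (v : E) :
    fderiv ℝ (fderiv ℝ u) y v v ≤ 0 := by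
  have hline : ∀ t : ℝ, HasDerivAt (fun t : ℝ => y + t • v) v t := fun t => by
    simpa using ((hasDerivAt_id t).smul_const v).const_add y
  have hlim : Tendsto (fun t : ℝ => y + t • v) (𝓝 0) (𝓝 y) := by
    have := (hline 0).continuousAt
    simpa [ContinuousAt] using this
  have hmax : IsLocalMax (fun t : ℝ => u (y + t • v)) 0 := by
    have : ∀ᶠ t in 𝓝 (0 : ℝ), u (y + t • v) ≤ u y := hlim.eventually h
    filter_upwards [this] with t ht
    simpa using ht
  have hd : ∀ᶠ z in 𝓝 y, DifferentiableAt ℝ u z := by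
    filter_upwards [(hu.of_le (m := 1) (by exact_mod_cast le_top)).eventually (by simp)] with z hz
    exact hz.differentiableAt (by simp)
  have h1 : deriv (fun t : ℝ => u (y + t • v)) =ᶠ[𝓝 0] fun t => fderiv ℝ u (y + t • v) v := by
    filter_upwards [hlim.eventually hd] with t ht
    exact (ht.hasFDerivAt.comp_hasDerivAt t (hline t)).deriv
  have h2 : DifferentiableAt ℝ (fderiv ℝ u) (y + (0 : ℝ) • v) := by
    simpa using (hu.fderiv_right (m := ∞) (by simp)).differentiableAt (by simp)
  have h3 : HasDerivAt (fun t : ℝ => fderiv ℝ u (y + t • v) v)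
      (fderiv ℝ (fderiv ℝ u) (y + (0 : ℝ) • v) v v) 0 := by
    have h : HasDerivAt (fun t : ℝ => fderiv ℝ u (y + t • v))
        (fderiv ℝ (fderiv ℝ u) (y + (0 : ℝ) • v) v) 0 :=
      h2.hasFDerivAt.comp_hasDerivAt (0 : ℝ) (hline 0)
    exact ((ContinuousLinearMap.apply ℝ ℝ v).hasFDerivAt.comp_hasDerivAt 0 h)
  have h4 := deriv_deriv_nonpos_of_isLocalMax hmax
    (ContinuousAt.comp (f := fun t : ℝ => y + t • v) (g := u)
      (by simpa using hu.continuousAt) (hline 0).continuousAt)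
  rw [h1.deriv_eq, h3.deriv] at h4
  simpa using h4

variable {G : (𝔼 m) → Matrix (Fin m) (Fin m) ℝ} {y : 𝔼 m}

lemma partialDeriv_partialDeriv {u : (𝔼 m) → ℝ} (hu : ContDiffAt ℝ ∞ u y) (i j : Fin m) :
    partialDeriv j (partialDeriv i u) y = fderiv ℝ (fderiv ℝ u) y
      (EuclideanSpace.single j 1) (EuclideanSpace.single i 1) := by
  have h1 : DifferentiableAt ℝ (fderiv ℝ u) y :=
    (hu.fderiv_right (m := ∞) (by simp)).differentiableAt (by simp)
  have := fderiv_clm_apply h1 (differentiableAt_const (EuclideanSpace.single i (1 : ℝ)))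
  change fderiv ℝ (fun y => fderiv ℝ u y (EuclideanSpace.single i 1)) y
    (EuclideanSpace.single j 1) = _
  rw [this]
  simp

/-- Applied to the inverse metric, this turns a trace against G⁻¹ into a sum of values of a
quadratic form, so that signs can be read off termwise. -/
lemma exists_gram_of_posSemidef {P : Matrix (Fin m) (Fin m) ℝ} (hP : P.PosSemidef) :
    ∃ (n : ℕ) (B : Fin n → Fin m → ℝ), ∀ i j, P i j = ∑ k, B k i * B k j := by
  obtain ⟨n, B, hB⟩ := Matrix.posSemidef_iff_eq_sum_vecMulVec.1 hP
  refine ⟨n, B, fun i j => ?_⟩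
  rw [hB, Matrix.sum_apply]
  simp [Matrix.vecMulVec_apply]

/-- At a critical point the first-order terms drop out and the Laplacian is the trace of G⁻¹ times
the Hessian, that is, a sum of values of the Hessian on the diagonal. -/
lemma coordLaplacian_nonpos_of_isLocalMax (hG : ∀ i j, ContDiffAt ℝ ∞ (fun z => G z i j) y)
    (hpos : (G y).PosDef) {u : (𝔼 m) → ℝ} (hu : ContDiffAt ℝ ∞ u y) (h : IsLocalMax u y) :
    coordLaplacian G u y ≤ 0 := by
  have h0 := hpos.det_pos
  have hgrad : ∀ i, partialDeriv i u y = 0 := fun i => by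
    simp [partialDeriv, h.fderiv_eq_zero]
  obtain ⟨n, B, hB⟩ := exists_gram_of_posSemidef hpos.inv.posSemidef
  have key : ∀ i j, partialDeriv j
      (fun z => ((G z)⁻¹ i j * √(G z).det) • partialDeriv i u z) y
      = √(G y).det * ∑ k, B k i * B k j * fderiv ℝ (fderiv ℝ u) y
        (EuclideanSpace.single j 1) (EuclideanSpace.single i 1) := by
    intro i j
    rw [partialDeriv_smul (differentiableAt_of_smooth (contDiffAt_weight hG h0 i j))
      (differentiableAt_of_smooth (contDiffAt_partialDeriv hu i)), hgrad,
      partialDeriv_partialDeriv hu, ← Finset.sum_mul, hB]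
    rw [smul_eq_mul]
    ring
  have hsum : ∀ k, fderiv ℝ (fderiv ℝ u) y (WithLp.toLp 2 (B k)) (WithLp.toLp 2 (B k))
      = ∑ i, ∑ j, B k i * B k j * fderiv ℝ (fderiv ℝ u) y
        (EuclideanSpace.single j 1) (EuclideanSpace.single i 1) := by
    intro k
    rw [fderiv_apply_eq_sum]
    refine Finset.sum_congr rfl fun i _ => ?_
    rw [fderiv_apply_eq_sum (fderiv ℝ (fderiv ℝ u) y), sum_apply,
      Finset.smul_sum]
    refine Finset.sum_congr rfl fun j _ => ?_
    simp [mul_assoc]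
  have h5 : coordLaplacian G u y = (√(G y).det)⁻¹ * (√(G y).det *
      ∑ k, fderiv ℝ (fderiv ℝ u) y (WithLp.toLp 2 (B k)) (WithLp.toLp 2 (B k))) := by
    simp only [coordLaplacian]
    rw [Finset.sum_congr rfl fun i _ => Finset.sum_congr rfl fun j _ => key i j]
    simp only [hsum, smul_eq_mul, ← Finset.mul_sum]
    congr 2
    symm
    rw [Finset.sum_comm]
    refine Finset.sum_congr rfl fun i _ => ?_
    rw [Finset.sum_comm]
  rw [h5, ← mul_assoc, inv_mul_cancel₀ (Real.sqrt_pos.2 h0).ne', one_mul]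
  exact Finset.sum_nonpos fun k _ => hessian_nonpos_of_isLocalMax hu h _

lemma gradInner_pos (hpos : (G y).PosDef) {u : (𝔼 m) → ℝ}
    (hu : ∃ i, partialDeriv i u y ≠ 0) : 0 < gradInner G u u y := by
  have hne : (fun i => partialDeriv i u y) ≠ 0 := fun h => by
    obtain ⟨i, hi⟩ := hu
    exact hi (congrFun h i)
  have h := hpos.inv.dotProduct_mulVec_pos hne
  have h1 : gradInner G u u y = star (fun i => partialDeriv i u y) ⬝ᵥ
      ((G y)⁻¹).mulVec (fun i => partialDeriv i u y) := by
    simp only [gradInner, dotProduct, Matrix.mulVec, Finset.mul_sum, Pi.star_apply, star_trivial]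
    exact Finset.sum_congr rfl fun i _ => Finset.sum_congr rfl fun j _ => by ring
  rw [h1]
  exact h

/-- The Gaussian barrier `exp (-α (|x - z|² - R²)) - 1` is strictly subharmonic at a given
point off the centre, for `α` large. -/
lemma exists_barrier (hG : ∀ i j, ContDiffAt ℝ ∞ (fun z => G z i j) y)
    (hpos : (G y).PosDef) {z : 𝔼 m} (hz : y ≠ z) (R : ℝ) :
    ∃ α > 0, 0 < coordLaplacian G
      (fun x => Real.exp (-α * (‖x - z‖ ^ 2 - R ^ 2)) - 1) y := by
  set ρ : (𝔼 m) → ℝ := fun x => ‖x - z‖ ^ 2 - R ^ 2 with hρ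
  have hρs : ContDiffAt ℝ ∞ ρ y := by
    have : ContDiff ℝ ∞ ρ := ((contDiff_id.sub contDiff_const).norm_sq ℝ).sub contDiff_const
    exact this.contDiffAt
  have hgrad : ∃ i, partialDeriv i ρ y ≠ 0 := by
    by_contra! hcon
    apply hz
    have h1 : ∀ i, partialDeriv i ρ y = 2 * (y - z) i := by
      intro i
      have h2 : HasFDerivAt ρ (2 • (innerSL ℝ (y - z)).comp (ContinuousLinearMap.id ℝ (𝔼 m))) y :=
        (((hasFDerivAt_id y).sub_const z).norm_sq).sub_const _
      rw [partialDeriv, h2.fderiv]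
      simp [PiLp.inner_apply]
    ext i
    have := hcon i
    rw [h1] at this
    simp at this
    linarith
  have hκ := gradInner_pos hpos hgrad
  set κ := gradInner G ρ ρ y
  set L := coordLaplacian G ρ y with hL
  -- By the chain rule the Laplacian of the barrier is α exp(-αρ)(ακ - L); this α makes ακ = |L| + 1
  -- > L.
  refine ⟨(|L| + 1) / κ, by positivity, ?_⟩
  set α := (|L| + 1) / κ with hα
  have hα0 : 0 < α := by positivity
  have hακ : α * κ = |L| + 1 := by rw [hα]; field_simp
  have hf : ∀ t : ℝ, HasDerivAt (fun t => Real.exp (-α * t) - 1) (-α * Real.exp (-α * t)) t := by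
    intro t
    have := (((hasDerivAt_id t).const_mul (-α)).exp).sub_const 1
    simpa [mul_comm] using this
  have hf1 : deriv (fun t => Real.exp (-α * t) - 1) = fun t => -α * Real.exp (-α * t) :=
    funext fun t => (hf t).deriv
  have hf2 : ∀ t : ℝ, HasDerivAt (fun t => -α * Real.exp (-α * t)) (α ^ 2 * Real.exp (-α * t)) t := by
    intro t
    have := (((hasDerivAt_id t).const_mul (-α)).exp).const_mul (-α)
    exact this.congr_deriv (by rw [id_eq]; ring)
  have hsm : ContDiff ℝ ∞ (fun t : ℝ => Real.exp (-α * t) - 1) := by fun_prop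
  have := coordLaplacian_scalar_comp hG hpos.det_pos hsm hρs
  simp only [hf1, (hf2 _).deriv, smul_eq_mul] at this
  rw [this]
  have h6 : L * (-α * Real.exp (-α * ρ y)) + κ * (α ^ 2 * Real.exp (-α * ρ y))
      = α * Real.exp (-α * ρ y) * (α * κ - L) := by ring
  rw [h6, hακ]
  have := le_abs_self L
  have : 0 < |L| + 1 - L := by linarith
  positivity

/-- The strong maximum principle for the Laplacian, in a ball: a subharmonic function that takes its
maximum at the centre is constant on a smaller ball. -/
lemma strong_maximum_ball {r : ℝ} (hr : 0 < r)
    (hG : ∀ x ∈ Metric.ball y r, ∀ i j, ContDiffAt ℝ ∞ (fun z => G z i j) x)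
    (hpos : ∀ x ∈ Metric.ball y r, (G x).PosDef) {u : (𝔼 m) → ℝ}
    (hu : ∀ x ∈ Metric.ball y r, ContDiffAt ℝ ∞ u x)
    (hL : ∀ x ∈ Metric.ball y r, 0 ≤ coordLaplacian G u x)
    (hmax : ∀ x ∈ Metric.ball y r, u x ≤ u y) :
    ∀ x ∈ Metric.ball y (r / 4), u x = u y := by
  intro x hx
  by_contra hne
  have hxlt : u x < u y := lt_of_le_of_ne (hmax x (Metric.ball_subset_ball (by linarith) hx)) hne
  have hxy : dist x y < r / 4 := hx
  have hsub : Metric.closedBall y (r / 2) ⊆ Metric.ball y r :=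
    Metric.closedBall_subset_ball (by linarith)
  have hucont : ContinuousOn u (Metric.closedBall y (r / 2)) := fun p hp =>
    (hu p (hsub hp)).continuousAt.continuousWithinAt
  -- The closed ball of radius r/2 makes the maximum set compact. Since x lies within r/4 of y, the
  -- point p of S nearest to x satisfies d(p, y) ≤ 2 d(x, y) < r/2, so it is interior to that ball.
  set S : Set (𝔼 m) := Metric.closedBall y (r / 2) ∩ u ⁻¹' {u y} with hS
  have hSc : IsCompact S := by
    refine (isCompact_closedBall y (r / 2)).of_isClosed_subset ?_ Set.inter_subset_left
    exact hucont.preimage_isClosed_of_isClosed Metric.isClosed_closedBall isClosed_singleton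
  have hSne : S.Nonempty := ⟨y, by simp [hS]; linarith⟩
  -- the point of the maximum set nearest to `x`
  obtain ⟨p, hpS, hpmin⟩ := hSc.exists_isMinOn hSne
    (f := fun q => dist q x) (by fun_prop)
  have hpmin' : ∀ q ∈ S, dist p x ≤ dist q x := fun q hq => hpmin hq
  have hup : u p = u y := hpS.2
  have hpx : p ≠ x := fun h => hne (h ▸ hup)
  have hpxy : dist p x ≤ dist y x := hpmin' y ⟨by simp; linarith, rfl⟩
  have hpy : dist p y < r / 2 := by
    have := dist_triangle p x y
    rw [dist_comm y x] at hpxy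
    linarith
  -- The ball with diameter px lies inside the ball around x through p, which has no point of S in
  -- its interior, and the two spheres meet only at p. Halving the ball thus makes the contact point
  -- unique.
  set R := dist p x / 2 with hR
  have hdpx : 0 < dist p x := dist_pos.2 hpx
  have hR0 : 0 < R := by positivity
  set z := midpoint ℝ p x with hz
  have hpz : dist p z = R := by rw [hz, dist_left_midpoint]; simp [hR]; ring
  have hxz : dist x z = R := by rw [hz, dist_right_midpoint]; simp [hR]; ring
  have hpz' : p ≠ z := fun h => by rw [← dist_eq_zero, hpz] at h; exact hR0.ne' h
  -- the closed ball around `z` touches the maximum set only at `p`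
  have htouch : ∀ q ∈ Metric.closedBall y (r / 2), dist q z ≤ R → u q = u y → q = p := by
    intro q hq hqz huq
    have h1 := hpmin' q ⟨hq, huq⟩
    have h2 : dist q x ≤ dist q z + dist z x := dist_triangle _ _ _
    have h3 : dist z x = R := by rw [dist_comm, hxz]
    have hqz' : dist q z = R := by
      apply le_antisymm hqz
      linarith [h1, h2, h3, hR]
    have h4 : dist q x = dist q z + dist z x := by
      apply le_antisymm h2
      rw [hqz', h3]
      linarith [h1, hR]
    have h5 : z = midpoint ℝ q x := by
      apply eq_midpoint_of_dist_eq_half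
      · rw [hqz', h4, hqz', h3]; ring
      · rw [h3, h4, hqz', h3]; ring
    rw [hz, midpoint_eq_smul_add, midpoint_eq_smul_add] at h5
    have h6 := smul_right_injective _ (by norm_num : (⅟2 : ℝ) ≠ 0) h5
    exact (add_right_cancel h6).symm
  have hpball : p ∈ Metric.ball y r := hsub hpS.1
  obtain ⟨α, hα0, hα⟩ := exists_barrier (hG p hpball) (hpos p hpball) hpz' R
  set v : (𝔼 m) → ℝ := fun x => Real.exp (-α * (‖x - z‖ ^ 2 - R ^ 2)) - 1 with hv
  have hvs : ContDiff ℝ ∞ v := by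
    have : ContDiff ℝ ∞ (fun x : 𝔼 m => ‖x - z‖ ^ 2) :=
      (contDiff_id.sub contDiff_const).norm_sq ℝ
    exact ((contDiff_const.mul (this.sub contDiff_const)).exp).sub contDiff_const
  have hvp : v p = 0 := by simp [hv, ← dist_eq_norm, hpz]
  have hvneg : ∀ q, R < dist q z → v q < 0 := by
    intro q hq
    have h1 : R ^ 2 < ‖q - z‖ ^ 2 := by
      rw [← dist_eq_norm]; gcongr
    have h2 : -α * (‖q - z‖ ^ 2 - R ^ 2) < 0 := by nlinarith
    have := Real.exp_lt_one_iff.2 h2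
    simp only [hv]; linarith
  have hnear : ∀ᶠ q in 𝓝 p, 0 < coordLaplacian G v q :=
    (contDiffAt_coordLaplacian (hG p hpball) (hpos p hpball).det_pos
      hvs.contDiffAt).continuousAt.eventually_const_lt hα
  obtain ⟨s, hs0, hs⟩ := Metric.eventually_nhds_iff_ball.1
    (hnear.and (Metric.isOpen_ball.eventually_mem (Metric.mem_ball.2 hpy)))
  set K := Metric.closedBall p (s / 2) with hK
  have hKs : K ⊆ Metric.ball p s := Metric.closedBall_subset_ball (by linarith)
  have hKy : K ⊆ Metric.closedBall y (r / 2) := fun q hq =>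
    Metric.ball_subset_closedBall (hs q (hKs hq)).2
  -- on the part of the sphere inside the ball around `z`, `u` stays below its maximum
  set T := Metric.sphere p (s / 2) ∩ Metric.closedBall z R with hT
  have hTc : IsCompact T := (isCompact_sphere p (s / 2)).inter_right Metric.isClosed_closedBall
  have hTK : T ⊆ K := fun q hq => Metric.sphere_subset_closedBall hq.1
  have hTlt : ∀ q ∈ T, u q < u y := by
    intro q hq
    refine lt_of_le_of_ne (hmax q (hsub (hKy (hTK hq)))) fun h => ?_
    have := htouch q (hKy (hTK hq)) hq.2 h
    have h2 : dist q p = s / 2 := hq.1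
    rw [this, dist_self] at h2
    linarith
  -- On the compact set T, `u` stays a definite amount below its maximum and `v` is bounded above,
  -- so this ε uses up at most half of the gap.
  have hε : ∃ ε > 0, ∀ q ∈ T, u q + ε * v q < u y := by
    rcases T.eq_empty_or_nonempty with hTe | hTne
    · exact ⟨1, one_pos, by simp [hTe]⟩
    · obtain ⟨q₀, hq₀, hq₀max⟩ := hTc.exists_isMaxOn hTne (hucont.mono (hTK.trans hKy))
      obtain ⟨q₁, hq₁, hq₁max⟩ := hTc.exists_isMaxOn hTne hvs.continuous.continuousOn
      have h1 := hTlt q₀ hq₀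
      refine ⟨(u y - u q₀) / (2 * (|v q₁| + 1)), div_pos (by linarith) (by positivity),
        fun q hq => ?_⟩
      have h2 : u q ≤ u q₀ := hq₀max hq
      have h3 : v q ≤ v q₁ := hq₁max hq
      have h4 : v q ≤ |v q₁| + 1 := by linarith [le_abs_self (v q₁)]
      have h5 : (u y - u q₀) / (2 * (|v q₁| + 1)) * v q ≤ (u y - u q₀) / 2 := by
        calc _ ≤ (u y - u q₀) / (2 * (|v q₁| + 1)) * (|v q₁| + 1) :=
              mul_le_mul_of_nonneg_left h4 (div_nonneg (by linarith) (by positivity))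
          _ = (u y - u q₀) / 2 := by
              have : |v q₁| + 1 ≠ 0 := by positivity
              field_simp
      linarith
  obtain ⟨ε, hε0, hεT⟩ := hε
  set w : (𝔼 m) → ℝ := fun q => u q + ε • v q with hw
  have hwcont : ContinuousOn w K :=
    (hucont.mono hKy).add (hvs.continuous.continuousOn.const_smul ε)
  obtain ⟨q, hqK, hqmax⟩ := (isCompact_closedBall p (s / 2)).exists_isMaxOn
    ⟨p, by simp; linarith⟩ hwcont
  have hwq : u y ≤ w q := by
    have : w p ≤ w q := hqmax (by simp; linarith)
    simpa [hw, hvp, hup] using this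
  -- On the boundary of K the function `w` is below u(y): on T by the choice of ε, and outside the
  -- ball around z because `v` is negative there. Since w(p) = u(y), the maximum is interior; there
  -- Δw ≤ 0 contradicts Δu ≥ 0 and Δv > 0.
  have hqint : dist q p < s / 2 := by
    refine lt_of_le_of_ne hqK fun h => ?_
    by_cases hqz : dist q z ≤ R
    · have := hεT q ⟨h, hqz⟩
      simp only [hw, smul_eq_mul] at hwq
      linarith
    · have h1 := hvneg q (not_le.1 hqz)
      have h2 := hmax q (hsub (hKy hqK))
      simp only [hw, smul_eq_mul] at hwq
      nlinarith
  have hqb := hsub (hKy hqK)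
  have hloc : IsLocalMax w q := hqmax.isLocalMax
    (Filter.mem_of_superset (Metric.isOpen_ball.mem_nhds hqint) Metric.ball_subset_closedBall)
  have hεv : ContDiffAt ℝ ∞ (fun q => ε • v q) q := (hvs.const_smul ε).contDiffAt
  have h1 := coordLaplacian_nonpos_of_isLocalMax (hG q hqb) (hpos q hqb)
    ((hu q hqb).add hεv) hloc
  have h2 : coordLaplacian G w q = coordLaplacian G u q + ε • coordLaplacian G v q := by
    rw [hw, coordLaplacian_add (hG q hqb) (hpos q hqb).det_pos (hu q hqb) hεv]
    congr 1
    exact coordLaplacian_clm_comp (hG q hqb) (hpos q hqb).det_pos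
      (ε • ContinuousLinearMap.id ℝ ℝ) hvs.contDiffAt
  have h3 := hL q hqb
  have h4 := (hs q (hKs hqK)).1
  have h5 : 0 < ε • coordLaplacian G v q := mul_pos hε0 h4
  have h6 : coordLaplacian G w q ≤ 0 := h1
  rw [h2] at h6
  linarith

end MaximumPrinciple

/-! ### Piola's identity and coordinate invariance of the Laplacian -/

section ChangeOfCoordinates

variable {m : ℕ}

lemma partialDeriv_prod {ι : Type*} [Fintype ι] [DecidableEq ι] {u : ι → (𝔼 m) → ℝ} {y : 𝔼 m}
    (hu : ∀ a, DifferentiableAt ℝ (u a) y) (l : Fin m) :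
    partialDeriv l (fun z => ∏ a, u a z) y
      = ∑ a, (∏ b ∈ Finset.univ.erase a, u b y) * partialDeriv l (u a) y := by
  have h1 := (HasFDerivAt.finsetProd (u := Finset.univ) (x := y)
    (g := u) fun a _ => (hu a).hasFDerivAt).fderiv
  rw [partialDeriv, h1, sum_apply]
  rfl

/-- Jacobi's formula for the derivative of a determinant. -/
lemma partialDeriv_det {ι : Type*} [Fintype ι] [DecidableEq ι] {J : (𝔼 m) → Matrix ι ι ℝ} {y : 𝔼 m}
    (hJ : ∀ i j, ContDiffAt ℝ ∞ (fun z => J z i j) y) (l : Fin m) :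
    partialDeriv l (fun z => (J z).det) y
      = ∑ i, ∑ a, (J y).adjugate i a * partialDeriv l (fun z => J z a i) y := by
  have hd : ∀ i j, DifferentiableAt ℝ (fun z => J z i j) y := fun i j =>
    differentiableAt_of_smooth (hJ i j)
  -- By Cramer's rule the right-hand side is a sum of determinants with one column differentiated,
  -- which is the Leibniz rule for the permutation expansion.
  have h1 : ∀ i, ∑ a, (J y).adjugate i a * partialDeriv l (fun z => J z a i) y
      = ((J y).updateCol i fun a => partialDeriv l (fun z => J z a i) y).det := by
    intro i
    rw [← Matrix.cramer_apply, Matrix.cramer_eq_adjugate_mulVec]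
    rfl
  simp only [h1, Matrix.det_apply']
  rw [partialDeriv_sum fun σ _ => ?_, Finset.sum_comm]
  swap
  · exact (differentiableAt_of_smooth (contDiffAt_prod fun i _ => hJ _ _)).const_mul _
  refine Finset.sum_congr rfl fun σ _ => ?_
  have h2 : partialDeriv l (fun z => ((Equiv.Perm.sign σ : ℤ) : ℝ) * ∏ i, J z (σ i) i) y
      = ((Equiv.Perm.sign σ : ℤ) : ℝ) * partialDeriv l (fun z => ∏ i, J z (σ i) i) y := by
    rw [partialDeriv_mul (differentiableAt_const _)
      (differentiableAt_of_smooth (contDiffAt_prod fun i _ => hJ _ _)), partialDeriv_const]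
    ring
  rw [h2, partialDeriv_prod (u := fun i z => J z (σ i) i) fun i => hd _ _, Finset.mul_sum]
  refine Finset.sum_congr rfl fun i _ => ?_
  rw [← Finset.mul_prod_erase _ _ (Finset.mem_univ i), Matrix.updateCol_self, mul_comm (∏ b ∈ _, _)]
  congr 2
  refine Finset.prod_congr rfl fun b hb => ?_
  rw [Matrix.updateCol_ne (Finset.ne_of_mem_erase hb)]

/-- The Jacobian matrix of a map, `(∂ᵢ Φ_a)_{a, i}`. -/
def jacobian {n : ℕ} (Φ : (𝔼 m) → 𝔼 n) (z : 𝔼 m) : Matrix (Fin n) (Fin m) ℝ :=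
  Matrix.of fun a i => partialDeriv i (fun z => Φ z a) z

lemma contDiffAt_apply {n : ℕ} {Φ : (𝔼 m) → 𝔼 n} {y : 𝔼 m} (hΦ : ContDiffAt ℝ ∞ Φ y) (a : Fin n) :
    ContDiffAt ℝ ∞ (fun z => Φ z a) y :=
  (EuclideanSpace.proj a : (𝔼 n) →L[ℝ] ℝ).contDiff.contDiffAt.comp y hΦ

lemma contDiffAt_jacobian {n : ℕ} {Φ : (𝔼 m) → 𝔼 n} {y : 𝔼 m} (hΦ : ContDiffAt ℝ ∞ Φ y)
    (a : Fin n) (i : Fin m) : ContDiffAt ℝ ∞ (fun z => jacobian Φ z a i) y :=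
  contDiffAt_partialDeriv (contDiffAt_apply hΦ a) i

/-- Piola's identity: the rows of the cofactor matrix of a Jacobian are divergence free. -/
lemma piola {Φ : (𝔼 m) → 𝔼 m} {y : 𝔼 m} (hΦ : ContDiffAt ℝ ∞ Φ y)
    (h0 : (jacobian Φ y).det ≠ 0) (a : Fin m) :
    ∑ i, partialDeriv i (fun z => (jacobian Φ z).adjugate i a) y = 0 := by
  have hJ := contDiffAt_jacobian hΦ
  have hadj := contDiffAt_adjugate hJ
  suffices h : (fun a => ∑ i, partialDeriv i (fun z => (jacobian Φ z).adjugate i a) y) = 0 from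
    congrFun h a
  -- As J is invertible, it suffices to show that the row vector of divergences times J vanishes.
  -- Taking the divergence of adj(J) J = det(J) I gives this product plus ∑ adj(J)ᵢₐ ∂ᵢJₐᵦ on the
  -- left and ∂ᵦ det J on the right. By Jacobi's formula and the symmetry ∂ᵢJₐᵦ = ∂ᵦJₐᵢ, the sum
  -- equals the right-hand side.
  refine Matrix.eq_zero_of_vecMul_eq_zero h0 ?_
  ext b
  have h1 : ∀ i, ∑ a, ((jacobian Φ y).adjugate i a * partialDeriv i (fun z => jacobian Φ z a b) y
      + partialDeriv i (fun z => (jacobian Φ z).adjugate i a) y * jacobian Φ y a b)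
      = partialDeriv i (fun z => (jacobian Φ z).det) y * (if i = b then 1 else 0) := by
    intro i
    have h2 : (fun z => ∑ a, (jacobian Φ z).adjugate i a * jacobian Φ z a b)
        = fun z => (jacobian Φ z).det * (if i = b then 1 else 0) := by
      funext z
      have := congrFun (congrFun (Matrix.adjugate_mul (jacobian Φ z)) i) b
      rwa [Matrix.mul_apply, Matrix.smul_apply, Matrix.one_apply, smul_eq_mul] at this
    have h3 := congrArg (fun f => partialDeriv i f y) h2
    beta_reduce at h3
    rw [partialDeriv_sum, partialDeriv_mul (differentiableAt_of_smooth (contDiffAt_det hJ))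
      (differentiableAt_const _), partialDeriv_const, mul_zero, zero_add] at h3
    · rw [← h3]
      refine Finset.sum_congr rfl fun a _ => ?_
      rw [partialDeriv_mul (differentiableAt_of_smooth (hadj i a))
        (differentiableAt_of_smooth (hJ a b))]
    · exact fun a _ => differentiableAt_of_smooth ((hadj i a).mul (hJ a b))
  have h4 := Finset.sum_congr (rfl : Finset.univ = Finset.univ) fun i _ => h1 i
  simp only [mul_ite, mul_one, mul_zero, Finset.sum_ite_eq', Finset.mem_univ, if_true,
    Finset.sum_add_distrib, partialDeriv_det hJ] at h4
  have h5 : ∀ i a, partialDeriv i (fun z => jacobian Φ z a b) y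
      = partialDeriv b (fun z => jacobian Φ z a i) y := fun i a =>
    partialDeriv_comm (contDiffAt_apply hΦ a) i b
  simp only [h5] at h4
  simp only [Matrix.vecMul, dotProduct, Finset.sum_mul, Pi.zero_apply]
  rw [Finset.sum_comm]
  linarith

lemma coordLaplacian_eq_div {F : Type*} [NormedAddCommGroup F] [NormedSpace ℝ F]
    {G : (𝔼 m) → Matrix (Fin m) (Fin m) ℝ} {y : 𝔼 m}
    (hG : ∀ i j, ContDiffAt ℝ ∞ (fun z => G z i j) y) (h0 : 0 < (G y).det) {u : (𝔼 m) → F}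
    (hu : ContDiffAt ℝ ∞ u y) :
    coordLaplacian G u y = (√(G y).det)⁻¹ • ∑ j, partialDeriv j
      (fun z => ∑ i, ((G z)⁻¹ i j * √(G z).det) • partialDeriv i u z) y := by
  simp only [coordLaplacian]
  rw [Finset.sum_comm]
  congr 1
  refine Finset.sum_congr rfl fun j _ => ?_
  rw [partialDeriv_sum fun i _ => differentiableAt_of_smooth (contDiffAt_flux hG h0 hu i j)]

/-- The Laplacian does not depend on the coordinates. -/
lemma coordLaplacian_comp {Φ : (𝔼 m) → 𝔼 m} {y : 𝔼 m} (hΦ : ContDiffAt ℝ ∞ Φ y)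
    (h0 : (jacobian Φ y).det ≠ 0) {G G' : (𝔼 m) → Matrix (Fin m) (Fin m) ℝ}
    (hG : ∀ i j, ContDiffAt ℝ ∞ (fun z => G z i j) (Φ y)) (hdet : 0 < (G (Φ y)).det)
    (hG' : ∀ᶠ z in 𝓝 y, G' z = (jacobian Φ z).transpose * G (Φ z) * jacobian Φ z)
    {u : (𝔼 m) → ℝ} (hu : ContDiffAt ℝ ∞ u (Φ y)) :
    coordLaplacian G' (fun z => u (Φ z)) y = coordLaplacian G u (Φ y) := by
  have hJ := contDiffAt_jacobian hΦ
  have hadj := contDiffAt_adjugate hJ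
  have hdetJ := contDiffAt_det hJ
  -- The locally constant sign s of det J replaces the absolute value, so that √det G' can be
  -- differentiated as a multiple of det J.
  obtain ⟨s, hs2, hs⟩ : ∃ s : ℝ, s ≠ 0 ∧
      ∀ᶠ z in 𝓝 y, |(jacobian Φ z).det| = s * (jacobian Φ z).det := by
    rcases lt_or_gt_of_ne h0 with h | h
    · refine ⟨-1, by norm_num, ?_⟩
      filter_upwards [hdetJ.continuousAt.eventually_lt_const h] with z hz
      rw [abs_of_neg hz]; ring
    · refine ⟨1, by norm_num, ?_⟩
      filter_upwards [hdetJ.continuousAt.eventually_const_lt h] with z hz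
      rw [abs_of_pos hz]; ring
  have hsqrt : ∀ᶠ z in 𝓝 y, √(G' z).det = s * (jacobian Φ z).det * √(G (Φ z)).det := by
    filter_upwards [hG', hs] with z hz hsz
    rw [hz, Matrix.det_mul, Matrix.det_mul, Matrix.det_transpose, mul_assoc, mul_comm,
      mul_assoc, ← pow_two, mul_comm, Real.sqrt_mul (sq_nonneg _), Real.sqrt_sq_eq_abs, hsz]
  set W : Fin m → (𝔼 m) → ℝ := fun c x =>
    ∑ b, ((G x)⁻¹ b c * √(G x).det) • partialDeriv b u x with hW
  have hWs : ∀ c, ContDiffAt ℝ ∞ (W c) (Φ y) := fun c =>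
    ContDiffAt.sum fun b _ => contDiffAt_flux hG hdet hu b c
  have hWΦ : ∀ c, ContDiffAt ℝ ∞ (fun z => W c (Φ z)) y := fun c => (hWs c).comp y hΦ
  have hΦd : ∀ᶠ z in 𝓝 y, DifferentiableAt ℝ Φ z := eventually_smooth hΦ
  have hud : ∀ᶠ z in 𝓝 y, DifferentiableAt ℝ u (Φ z) :=
    hΦ.continuousAt.eventually (eventually_smooth hu)
  have hdetG : ∀ᶠ z in 𝓝 y, (G (Φ z)).det ≠ 0 :=
    hΦ.continuousAt.eventually ((contDiffAt_det hG).continuousAt.eventually_ne hdet.ne')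
  have hJ0 : ∀ᶠ z in 𝓝 y, (jacobian Φ z).det ≠ 0 := hdetJ.continuousAt.eventually_ne h0
  -- The flux transforms by s adj(J): the factor det J from the volume density turns J⁻¹ into the
  -- adjugate, whose divergence is then controlled by Piola's identity.
  have hflux : ∀ j, (fun z => ∑ i, ((G' z)⁻¹ i j * √(G' z).det) •
        partialDeriv i (fun z => u (Φ z)) z)
      =ᶠ[𝓝 y] fun z => ∑ c, s * ((jacobian Φ z).adjugate j c * W c (Φ z)) := by
    intro j
    filter_upwards [hG', hsqrt, hΦd, hud, hdetG, hJ0] with z h1 h2 h3 h4 h5 h6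
    have h7 : jacobian Φ z * (G' z)⁻¹ = (G (Φ z))⁻¹ * ((jacobian Φ z)⁻¹).transpose := by
      rw [h1, Matrix.mul_inv_rev, Matrix.mul_inv_rev, ← mul_assoc,
        Matrix.mul_nonsing_inv _ (isUnit_iff_ne_zero.2 h6), one_mul, Matrix.transpose_nonsing_inv]
    have h8 : ∀ i, partialDeriv i (fun z => u (Φ z)) z
        = ∑ a, jacobian Φ z a i * partialDeriv a u (Φ z) := fun i => partialDeriv_comp h4 h3 i
    have h9 : ∀ c, (jacobian Φ z).adjugate j c = (jacobian Φ z).det * (jacobian Φ z)⁻¹ j c := by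
      intro c
      rw [Matrix.inv_def, Ring.inverse_eq_inv', Matrix.smul_apply, smul_eq_mul, ← mul_assoc,
        mul_inv_cancel₀ h6, one_mul]
    have h10 : ∀ a, ∑ i, jacobian Φ z a i * (G' z)⁻¹ i j
        = ∑ c, (G (Φ z))⁻¹ a c * (jacobian Φ z)⁻¹ j c := by
      intro a
      have := congrFun (congrFun h7 a) j
      rwa [Matrix.mul_apply, Matrix.mul_apply] at this
    calc ∑ i, ((G' z)⁻¹ i j * √(G' z).det) • partialDeriv i (fun z => u (Φ z)) z
        = √(G' z).det * ∑ a, (∑ i, jacobian Φ z a i * (G' z)⁻¹ i j) * partialDeriv a u (Φ z) := by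
          simp only [h8, Finset.mul_sum, Finset.sum_mul, smul_eq_mul]
          rw [Finset.sum_comm]
          exact Finset.sum_congr rfl fun a _ => Finset.sum_congr rfl fun i _ => by ring
      _ = ∑ c, s * ((jacobian Φ z).adjugate j c * W c (Φ z)) := by
          simp only [h10, h2, hW, h9, Finset.mul_sum, Finset.sum_mul, smul_eq_mul]
          rw [Finset.sum_comm]
          exact Finset.sum_congr rfl fun a _ => Finset.sum_congr rfl fun i _ => by ring
  have hG's : ∀ i j, ContDiffAt ℝ ∞ (fun z => G' z i j) y := by
    intro i j
    have h1 : (fun z => G' z i j)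
        =ᶠ[𝓝 y] fun z => ∑ b, (∑ a, jacobian Φ z a i * G (Φ z) a b) * jacobian Φ z b j := by
      filter_upwards [hG'] with z hz
      rw [hz, Matrix.mul_apply]
      simp only [Matrix.mul_apply, Matrix.transpose_apply]
    refine ContDiffAt.congr_of_eventuallyEq ?_ h1
    refine ContDiffAt.sum fun b _ => ContDiffAt.mul (ContDiffAt.sum fun a _ => ?_) (hJ b j)
    exact (hJ a i).mul ((hG a b).comp y hΦ)
  have hdet' : 0 < (G' y).det := by
    rw [hG'.self_of_nhds, Matrix.det_mul, Matrix.det_mul, Matrix.det_transpose]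
    have := mul_self_pos.2 h0
    nlinarith [mul_pos this hdet]
  rw [coordLaplacian_eq_div hG's hdet' (u := fun z => u (Φ z)) (hu.comp y hΦ),
    coordLaplacian_eq_div hG hdet hu, hsqrt.self_of_nhds]
  have hterm : ∀ j, partialDeriv j (fun z => ∑ i, ((G' z)⁻¹ i j * √(G' z).det) •
        partialDeriv i (fun z => u (Φ z)) z) y
      = s * (∑ c, ∑ b, (jacobian Φ y b j * (jacobian Φ y).adjugate j c) * partialDeriv b (W c) (Φ y)
        + ∑ c, partialDeriv j (fun z => (jacobian Φ z).adjugate j c) y * W c (Φ y)) := by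
    intro j
    have hprod : ∀ c, ContDiffAt ℝ ∞ (fun z => (jacobian Φ z).adjugate j c * W c (Φ z)) y :=
      fun c => (hadj j c).mul (hWΦ c)
    rw [partialDeriv_congr (hflux j), partialDeriv_sum fun c _ =>
      (differentiableAt_of_smooth (hprod c)).const_mul s, ← Finset.sum_add_distrib, Finset.mul_sum]
    refine Finset.sum_congr rfl fun c _ => ?_
    rw [partialDeriv_mul (differentiableAt_const s) (differentiableAt_of_smooth (hprod c)),
      partialDeriv_mul (differentiableAt_of_smooth (hadj j c)) (differentiableAt_of_smooth (hWΦ c)),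
      partialDeriv_comp (differentiableAt_of_smooth (hWs c)) (differentiableAt_of_smooth hΦ),
      partialDeriv_const, zero_mul, add_zero, Finset.mul_sum]
    congr 2
    refine Finset.sum_congr rfl fun b _ => ?_
    simp only [jacobian, Matrix.of_apply, smul_eq_mul]
    ring
  have hsum : ∑ j, partialDeriv j (fun z => ∑ i, ((G' z)⁻¹ i j * √(G' z).det) •
        partialDeriv i (fun z => u (Φ z)) z) y
      = s * (jacobian Φ y).det * ∑ c, partialDeriv c (W c) (Φ y) := by
    simp only [hterm]
    rw [← Finset.mul_sum, Finset.sum_add_distrib]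
    have hz : ∑ j, ∑ c, partialDeriv j (fun z => (jacobian Φ z).adjugate j c) y * W c (Φ y) = 0 := by
      rw [Finset.sum_comm]
      refine Finset.sum_eq_zero fun c _ => ?_
      rw [← Finset.sum_mul, piola hΦ h0, zero_mul]
    rw [hz, add_zero, mul_assoc]
    congr 1
    rw [Finset.sum_comm, Finset.mul_sum]
    refine Finset.sum_congr rfl fun c _ => ?_
    rw [Finset.sum_comm]
    have hb : ∀ b, ∑ j, jacobian Φ y b j * (jacobian Φ y).adjugate j c
        = (jacobian Φ y).det * (if b = c then 1 else 0) := by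
      intro b
      have := congrFun (congrFun (Matrix.mul_adjugate (jacobian Φ y)) b) c
      rwa [Matrix.mul_apply, Matrix.smul_apply, Matrix.one_apply, smul_eq_mul] at this
    simp only [← Finset.sum_mul, hb, mul_ite, mul_one, mul_zero, ite_mul, zero_mul,
      Finset.sum_ite_eq', Finset.mem_univ, if_true]
  rw [hsum, smul_eq_mul, smul_eq_mul]
  change _ = _ * ∑ c, partialDeriv c (W c) (Φ y)
  have := (Real.sqrt_pos.2 hdet).ne'
  field_simp

end ChangeOfCoordinates

/-! ### Metric coefficients in charts and the global maximum principle -/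

section RiemannianCoordinates

variable {m : ℕ} {M : Type*} [TopologicalSpace M]
  [ChartedSpace (EuclideanSpace ℝ (Fin m)) M] [IsManifold (𝓡 m) ∞ M]

/-- The trivialization of the tangent bundle given by the preferred chart around `x`. -/
abbrev chartTriv (x : M) := trivializationAt (𝔼 m) (TangentSpace (𝓡 m) : M → Type _) x

lemma mem_chartTriv_baseSet {x q : M} :
    q ∈ (chartTriv (m := m) x).baseSet ↔ q ∈ (extChartAt (𝓡 m) x).source := by
  rw [extChartAt_source]
  exact Iff.rfl

/-- Smoothness and linear independence of the coordinate fields are inherited from the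
trivialization of the tangent bundle. -/
lemma coordVector_eq (x : M) {y : 𝔼 m} (hy : y ∈ (extChartAt (𝓡 m) x).target) (i : Fin m) :
    coordVector x y i = (chartTriv x).symmL ℝ ((extChartAt (𝓡 m) x).symm y)
      (EuclideanSpace.single i (1 : ℝ) : 𝔼 m) := by
  have hq := (extChartAt (𝓡 m) x).map_target hy
  rw [extChartAt_source] at hq
  rw [TangentBundle.symmL_trivializationAt hq, (extChartAt (𝓡 m) x).right_inv hy, coordVector,
    modelWithCornersSelf_coe, Set.range_id, mfderivWithin_univ]
  rfl

lemma contMDiffAt_chartTriv_symmL {x q : M} (hq : q ∈ (extChartAt (𝓡 m) x).source) (v : 𝔼 m) :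
    ContMDiffAt (𝓡 m) ((𝓡 m).prod 𝓘(ℝ, 𝔼 m)) ∞
      (fun p => Bundle.TotalSpace.mk' (𝔼 m) p ((chartTriv x).symmL ℝ p v) :
        M → Bundle.TotalSpace (𝔼 m) (TangentSpace (𝓡 m) : M → Type _)) q := by
  have hq' := mem_chartTriv_baseSet.2 hq
  rw [(chartTriv x).contMDiffAt_section_iff hq']
  refine ContMDiffAt.congr_of_eventuallyEq (contMDiffAt_const (c := v)) ?_
  filter_upwards [(chartTriv x).open_baseSet.mem_nhds hq'] with p hp
  have := (chartTriv (m := m) x).continuousLinearMapAt_symmL (R := ℝ) hp v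
  rwa [Bundle.Trivialization.continuousLinearMapAt_apply,
    Bundle.Trivialization.coe_linearMapAt_of_mem _ hp] at this

lemma contDiffAt_coordMetric (g : SmoothMetric m M) (x : M) {y : 𝔼 m}
    (hy : y ∈ (extChartAt (𝓡 m) x).target) (i j : Fin m) :
    ContDiffAt ℝ ∞ (fun z => coordMetric g x z i j) y := by
  have hq := (extChartAt (𝓡 m) x).map_target hy
  have hopen := (isOpen_extChartAt_target (I := 𝓡 m) x).mem_nhds hy
  have h1 : ContMDiffAt (𝓡 m) ((𝓡 m).prod 𝓘(ℝ)) ∞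
      (fun q => Bundle.TotalSpace.mk' ℝ (E := Bundle.Trivial M ℝ) q
        (g.inner q ((chartTriv x).symmL ℝ q (EuclideanSpace.single i (1 : ℝ)))
          ((chartTriv x).symmL ℝ q (EuclideanSpace.single j (1 : ℝ)))))
      ((extChartAt (𝓡 m) x).symm y) := by
    apply ContMDiffAt.clm_bundle_apply₂ (F₁ := 𝔼 m) (F₂ := 𝔼 m)
    · exact g.contMDiff.contMDiffAt
    · exact contMDiffAt_chartTriv_symmL hq _
    · exact contMDiffAt_chartTriv_symmL hq _
  rw [Bundle.contMDiffAt_totalSpace] at h1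
  have h2 := h1.2.comp y ((contMDiffOn_extChartAt_symm (n := ∞) x).contMDiffAt hopen)
  refine (contMDiffAt_iff_contDiffAt.1 h2).congr_of_eventuallyEq ?_
  filter_upwards [hopen] with z hz
  simp only [coordMetric, Matrix.of_apply, coordVector_eq x hz]
  rfl

lemma inner_sum_smul (g : SmoothMetric m M) (q : M) (c d : Fin m → ℝ)
    (V W : Fin m → TangentSpace (𝓡 m) q) :
    g.inner q (∑ i, c i • V i) (∑ j, d j • W j) = ∑ i, ∑ j, c i * d j * g.inner q (V i) (W j) := by
  simp only [map_sum, map_smul, sum_apply, smul_apply, smul_eq_mul, Finset.mul_sum]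
  rw [Finset.sum_comm]
  exact Finset.sum_congr rfl fun i _ => Finset.sum_congr rfl fun j _ => by ring

lemma coordMetric_posDef (g : SmoothMetric m M) (x : M) {y : 𝔼 m}
    (hy : y ∈ (extChartAt (𝓡 m) x).target) : (coordMetric g x y).PosDef := by
  set q := (extChartAt (𝓡 m) x).symm y with hqdef
  have hq : q ∈ (chartTriv (m := m) x).baseSet :=
    mem_chartTriv_baseSet.2 ((extChartAt (𝓡 m) x).map_target hy)
  rw [Matrix.posDef_iff_dotProduct_mulVec]
  refine ⟨?_, fun v hv => ?_⟩
  · ext i j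
    exact g.symm _ _ _
  · have h1 : star v ⬝ᵥ (coordMetric g x y).mulVec v
        = g.inner q (∑ i, v i • coordVector x y i) (∑ j, v j • coordVector x y j) := by
      rw [inner_sum_smul]
      simp only [dotProduct, Matrix.mulVec, Finset.mul_sum, Pi.star_apply, star_trivial]
      exact Finset.sum_congr rfl fun i _ => Finset.sum_congr rfl fun j _ => by
        simp only [coordMetric, Matrix.of_apply]
        ring
    rw [h1]
    refine g.pos q _ fun h0 => hv ?_
    have h2 : (∑ i, v i • coordVector x y i : TangentSpace (𝓡 m) q)
        = (chartTriv x).symmL ℝ q (WithLp.toLp 2 v : 𝔼 m) := by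
      rw [show (WithLp.toLp 2 v : 𝔼 m) = ∑ i, v i • EuclideanSpace.single i (1 : ℝ) from
        fderiv_apply_eq_sum (ContinuousLinearMap.id ℝ (𝔼 m)) _, map_sum]
      exact Finset.sum_congr rfl fun i _ => by rw [coordVector_eq x hy, map_smul]
    rw [h2] at h0
    have h3 := (chartTriv (m := m) x).continuousLinearMapAt_symmL (R := ℝ) hq (WithLp.toLp 2 v)
    rw [h0, map_zero] at h3
    funext i
    exact (congrArg (fun w : 𝔼 m => w i) h3).symm

/-- The change of coordinates from the preferred chart around `p` to the one around `x`. -/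
def coordChange (p x : M) (z : 𝔼 m) : 𝔼 m :=
  extChartAt (𝓡 m) x ((extChartAt (𝓡 m) p).symm z)

lemma contDiffAt_coordChange {p x : M} {z : 𝔼 m} (hz : z ∈ (extChartAt (𝓡 m) p).target)
    (hx : (extChartAt (𝓡 m) p).symm z ∈ (extChartAt (𝓡 m) x).source) :
    ContDiffAt ℝ ∞ (coordChange p x) z := by
  rw [extChartAt_source] at hx
  have h1 := (contMDiffAt_extChartAt' (I := 𝓡 m) (n := ∞) hx).comp z
    ((contMDiffOn_extChartAt_symm (n := ∞) p).contMDiffAt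
      ((isOpen_extChartAt_target (I := 𝓡 m) p).mem_nhds hz))
  exact contMDiffAt_iff_contDiffAt.1 h1

lemma eventually_mem_chart {p x : M} {z : 𝔼 m} (hz : z ∈ (extChartAt (𝓡 m) p).target)
    (hx : (extChartAt (𝓡 m) p).symm z ∈ (extChartAt (𝓡 m) x).source) :
    ∀ᶠ w in 𝓝 z, w ∈ (extChartAt (𝓡 m) p).target ∧
      (extChartAt (𝓡 m) p).symm w ∈ (extChartAt (𝓡 m) x).source := by
  refine ((isOpen_extChartAt_target (I := 𝓡 m) p).eventually_mem hz).and ?_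
  have h1 : ContinuousAt (extChartAt (𝓡 m) p).symm z :=
    ((contMDiffOn_extChartAt_symm (I := 𝓡 m) (n := ∞) p).contMDiffAt
      ((isOpen_extChartAt_target (I := 𝓡 m) p).mem_nhds hz)).continuousAt
  exact h1.eventually ((isOpen_extChartAt_source (I := 𝓡 m) x).eventually_mem hx)

lemma coordVector_change {p x : M} {z : 𝔼 m} (hz : z ∈ (extChartAt (𝓡 m) p).target)
    (hx : (extChartAt (𝓡 m) p).symm z ∈ (extChartAt (𝓡 m) x).source) (i : Fin m) :
    (coordVector p z i : 𝔼 m)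
      = ∑ a, jacobian (coordChange p x) z a i • (coordVector x (coordChange p x z) a : 𝔼 m) := by
  have h1 : (extChartAt (𝓡 m) p).symm =ᶠ[𝓝 z] (extChartAt (𝓡 m) x).symm ∘ coordChange p x := by
    filter_upwards [eventually_mem_chart hz hx] with w hw
    exact ((extChartAt (𝓡 m) x).left_inv hw.2).symm
  have hmem : coordChange p x z ∈ (extChartAt (𝓡 m) x).target := (extChartAt (𝓡 m) x).map_source hx
  have h2 : MDifferentiableAt 𝓘(ℝ, 𝔼 m) (𝓡 m) (extChartAt (𝓡 m) x).symm (coordChange p x z) :=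
    ((contMDiffOn_extChartAt_symm (n := ∞) x).contMDiffAt
      ((isOpen_extChartAt_target (I := 𝓡 m) x).mem_nhds hmem)).mdifferentiableAt (by simp)
  have h3 : DifferentiableAt ℝ (coordChange p x) z :=
    differentiableAt_of_smooth (contDiffAt_coordChange hz hx)
  have h4 := mfderiv_comp z h2 h3.mdifferentiableAt
  set D : (𝔼 m) →L[ℝ] (𝔼 m) := mfderiv 𝓘(ℝ, 𝔼 m) (𝓡 m)
    (extChartAt (𝓡 m) x).symm (coordChange p x z) with hD
  have h5 : (coordVector p z i : 𝔼 m) = D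
      (fderiv ℝ (coordChange p x) z (EuclideanSpace.single i 1)) := by
    rw [← mfderiv_eq_fderiv]
    have h6 := congrArg (fun L : (𝔼 m) →L[ℝ] (𝔼 m) => L (EuclideanSpace.single i 1))
      (h1.mfderiv_eq.trans h4)
    exact h6
  rw [h5, fderiv_apply_eq_sum D]
  refine Finset.sum_congr rfl fun a _ => ?_
  refine congrArg (fun c : ℝ => c • (coordVector x (coordChange p x z) a : 𝔼 m)) ?_
  exact (partialDeriv_clm_comp (EuclideanSpace.proj a : (𝔼 m) →L[ℝ] ℝ) h3 i).symm

/-- All tangent spaces are the model space by definition, so vectors can be kept fixed while the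
base point is replaced by an equal one. -/
lemma inner_congr_point (g : SmoothMetric m M) {q q' : M} (h : q = q') (v w : 𝔼 m) :
    (g.inner q : (𝔼 m) →L[ℝ] (𝔼 m) →L[ℝ] ℝ) v w
      = (g.inner q' : (𝔼 m) →L[ℝ] (𝔼 m) →L[ℝ] ℝ) v w := by
  subst h
  rfl

lemma coordMetric_change (g : SmoothMetric m M) {p x : M} {z : 𝔼 m}
    (hz : z ∈ (extChartAt (𝓡 m) p).target)
    (hx : (extChartAt (𝓡 m) p).symm z ∈ (extChartAt (𝓡 m) x).source) :
    coordMetric g p z = (jacobian (coordChange p x) z).transpose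
      * coordMetric g x (coordChange p x z) * jacobian (coordChange p x) z := by
  ext i j
  have h1 : coordMetric g p z i j = g.inner ((extChartAt (𝓡 m) x).symm (coordChange p x z))
      (∑ a, jacobian (coordChange p x) z a i • coordVector x (coordChange p x z) a)
      (∑ a, jacobian (coordChange p x) z a j • coordVector x (coordChange p x z) a) := by
    have h2 := inner_congr_point g ((extChartAt (𝓡 m) x).left_inv hx).symm
      (coordVector p z i) (coordVector p z j)
    refine Eq.trans h2 ?_
    rw [coordVector_change hz hx i, coordVector_change hz hx j]
    rfl
  rw [h1, inner_sum_smul, Matrix.mul_apply]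
  simp only [Matrix.mul_apply, Matrix.transpose_apply, Finset.sum_mul]
  rw [Finset.sum_comm]
  exact Finset.sum_congr rfl fun b _ => Finset.sum_congr rfl fun a _ => by
    simp only [coordMetric, Matrix.of_apply]
    ring

lemma contDiffAt_coordFun {F : Type*} [NormedAddCommGroup F] [NormedSpace ℝ F] {u : M → F}
    (hu : ContMDiff (𝓡 m) 𝓘(ℝ, F) ∞ u) (x : M) {y : 𝔼 m}
    (hy : y ∈ (extChartAt (𝓡 m) x).target) : ContDiffAt ℝ ∞ (coordFun x u) y := by
  have h1 := hu.contMDiffAt.comp y ((contMDiffOn_extChartAt_symm (n := ∞) x).contMDiffAt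
    ((isOpen_extChartAt_target (I := 𝓡 m) x).mem_nhds hy))
  exact contMDiffAt_iff_contDiffAt.1 h1

/-- The Laplacian of a function may be computed in any chart. -/
lemma coordLaplacian_chart (g : SmoothMetric m M) {u : M → ℝ}
    (hu : ContMDiff (𝓡 m) 𝓘(ℝ) ∞ u) {p x : M} (hp : p ∈ (extChartAt (𝓡 m) x).source) :
    coordLaplacian (coordMetric g p) (coordFun p u) (extChartAt (𝓡 m) p p)
      = coordLaplacian (coordMetric g x) (coordFun x u) (extChartAt (𝓡 m) x p) := by
  set y := extChartAt (𝓡 m) p p with hy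
  have hyt : y ∈ (extChartAt (𝓡 m) p).target := mem_extChartAt_target p
  have hsymm : (extChartAt (𝓡 m) p).symm y = p := extChartAt_to_inv p
  have hx : (extChartAt (𝓡 m) p).symm y ∈ (extChartAt (𝓡 m) x).source := by rwa [hsymm]
  have hΦy : coordChange p x y = extChartAt (𝓡 m) x p := by rw [coordChange, hsymm]
  have ht : coordChange p x y ∈ (extChartAt (𝓡 m) x).target := (extChartAt (𝓡 m) x).map_source hx
  have hG : ∀ᶠ z in 𝓝 y, coordMetric g p z = (jacobian (coordChange p x) z).transpose
      * coordMetric g x (coordChange p x z) * jacobian (coordChange p x) z := by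
    filter_upwards [eventually_mem_chart hyt hx] with z hz using coordMetric_change g hz.1 hz.2
  have hfun : coordFun p u =ᶠ[𝓝 y] fun z => coordFun x u (coordChange p x z) := by
    filter_upwards [eventually_mem_chart hyt hx] with z hz
    simp only [coordFun, coordChange, (extChartAt (𝓡 m) x).left_inv hz.2]
  -- The metric in the chart around p is the pullback by the coordinate change; a singular Jacobian
  -- would make it degenerate.
  have hdet : (jacobian (coordChange p x) y).det ≠ 0 := by
    intro h0
    have h1 := (coordMetric_posDef g p hyt).det_pos
    rw [hG.self_of_nhds, Matrix.det_mul, h0, mul_zero] at h1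
    exact lt_irrefl _ h1
  rw [coordLaplacian_congr (EventuallyEq.refl _ _) hfun,
    coordLaplacian_comp (contDiffAt_coordChange hyt hx) hdet
      (fun i j => contDiffAt_coordMetric g x ht i j) (coordMetric_posDef g x ht).det_pos hG
      (contDiffAt_coordFun hu x ht), hΦy]

/-- A subharmonic function on a compact connected Riemannian manifold is constant. -/
theorem eq_of_subharmonic [CompactSpace M] [ConnectedSpace M] (g : SmoothMetric m M) {u : M → ℝ}
    (hu : ContMDiff (𝓡 m) 𝓘(ℝ) ∞ u)
    (hL : ∀ p, 0 ≤ coordLaplacian (coordMetric g p) (coordFun p u) (extChartAt (𝓡 m) p p))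
    (p q : M) : u p = u q := by
  obtain ⟨x₀, -, hx₀⟩ := isCompact_univ.exists_isMaxOn Set.univ_nonempty hu.continuous.continuousOn
  have hmax : ∀ x, u x ≤ u x₀ := fun x => hx₀ (Set.mem_univ x)
  set S : Set M := u ⁻¹' {u x₀} with hS
  have hclosed : IsClosed S := isClosed_singleton.preimage hu.continuous
  have hopen : IsOpen S := by
    rw [isOpen_iff_mem_nhds]
    intro x hx
    have hux : u x = u x₀ := hx
    obtain ⟨r, hr, hball⟩ := Metric.isOpen_iff.1 (isOpen_extChartAt_target (I := 𝓡 m) x)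
      _ (mem_extChartAt_target x)
    have hsymm : (extChartAt (𝓡 m) x).symm (extChartAt (𝓡 m) x x) = x := extChartAt_to_inv x
    have key := strong_maximum_ball (y := extChartAt (𝓡 m) x x) (u := coordFun x u) hr
      (fun z hz i j => contDiffAt_coordMetric g x (hball hz) i j)
      (fun z hz => coordMetric_posDef g x (hball hz))
      (fun z hz => contDiffAt_coordFun hu x (hball hz))
      -- The hypothesis concerns each point in its own chart; chart independence moves it to the
      -- fixed chart around x.
      (fun z hz => by
        have h1 := hL ((extChartAt (𝓡 m) x).symm z)
        rwa [coordLaplacian_chart g hu ((extChartAt (𝓡 m) x).map_target (hball hz)),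
          (extChartAt (𝓡 m) x).right_inv (hball hz)] at h1)
      (fun z _ => by
        simp only [coordFun, hsymm, hux]
        exact hmax _)
    filter_upwards [(continuousAt_extChartAt (I := 𝓡 m) x).eventually_mem
      (Metric.ball_mem_nhds _ (by linarith : 0 < r / 4)),
      extChartAt_source_mem_nhds (I := 𝓡 m) x] with w hw hws
    have h2 := key _ hw
    simp only [coordFun, hsymm, (extChartAt (𝓡 m) x).left_inv hws] at h2
    exact h2.trans hux
  have huniv : S = Set.univ := IsClopen.eq_univ ⟨hclosed, hopen⟩ ⟨x₀, rfl⟩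
  have h : ∀ x, u x = u x₀ := fun x => by
    have : x ∈ S := huniv ▸ Set.mem_univ x
    exact this
  rw [h p, h q]

end RiemannianCoordinates

/-! ### Constancy of the modulus of an eigenfunction -/

section EigenfunctionNorm

variable {m : ℕ}

/-- The inner product of gradients is a sum of products of directional derivatives. -/
lemma gradInner_eq_sum {G : (𝔼 m) → Matrix (Fin m) (Fin m) ℝ} {y : 𝔼 m} (hG : (G y).PosDef) :
    ∃ (n : ℕ) (D : Fin n → ((𝔼 m) → ℝ) → ℝ),
      ∀ u v : (𝔼 m) → ℝ, gradInner G u v y = ∑ k, D k u * D k v := by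
  obtain ⟨n, B, hB⟩ := exists_gram_of_posSemidef hG.inv.posSemidef
  refine ⟨n, fun k u => ∑ i, B k i * partialDeriv i u y, fun u v => ?_⟩
  simp only [gradInner, hB, Finset.sum_mul_sum]
  symm
  rw [Finset.sum_comm]
  refine Finset.sum_congr rfl fun i _ => ?_
  rw [Finset.sum_comm]
  refine Finset.sum_congr rfl fun j _ => ?_
  rw [Finset.sum_mul, Finset.sum_mul]
  exact Finset.sum_congr rfl fun k _ => by ring

/-- The real inequality behind the subharmonicity of `|φ|²`. -/
lemma eigen_energy_bound {lam p q P Q R : ℝ} (hP : 0 ≤ P) (hQ : 0 ≤ Q) (hR : R ^ 2 ≤ P * Q)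
    (h1 : P - Q = -lam * (p ^ 2 - q ^ 2)) (h2 : R = -lam * (p * q)) :
    lam * (p ^ 2 + q ^ 2) ≤ P + Q := by
  refine le_of_sq_le_sq ?_ (by positivity)
  -- Comparing squares needs only P + Q ≥ 0, so `lam` may have either sign. The squares compare
  -- because (p² - q²)² + 4p²q² = (p² + q²)².
  have h3 : (P + Q) ^ 2 = (P - Q) ^ 2 + 4 * (P * Q) := by ring
  rw [h3, h1]
  rw [h2] at hR
  nlinarith

variable {M : Type*} [TopologicalSpace M]
  [ChartedSpace (EuclideanSpace ℝ (Fin m)) M] [IsManifold (𝓡 m) ∞ M]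

/-- On a compact connected manifold, a function with `τ(φ) = -λ φ` and `κ(φ, φ) = -λ φ²` for a
real number `λ` has constant modulus. -/
theorem norm_eq_of_eigenfunction [CompactSpace M] [ConnectedSpace M] (g : SmoothMetric m M)
    {φ : M → ℂ} (hφ : ContMDiff (𝓡 m) 𝓘(ℝ, ℂ) ∞ φ) {lam : ℝ}
    (hτ : ∀ x, laplaceBeltrami g φ x = -(lam : ℂ) * φ x)
    (hκ : ∀ x, conformality g φ φ x = -(lam : ℂ) * (φ x * φ x)) (p q : M) : ‖φ p‖ = ‖φ q‖ := by
  have hre : ContMDiff (𝓡 m) 𝓘(ℝ) ∞ (fun x => (φ x).re) :=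
    Complex.reCLM.contMDiff.comp hφ
  have him : ContMDiff (𝓡 m) 𝓘(ℝ) ∞ (fun x => (φ x).im) :=
    Complex.imCLM.contMDiff.comp hφ
  have hu : ContMDiff (𝓡 m) 𝓘(ℝ) ∞ (fun x => (φ x).re ^ 2 + (φ x).im ^ 2) :=
    (hre.pow 2).add (him.pow 2)
  have key : ∀ x, 0 ≤ coordLaplacian (coordMetric g x)
      (coordFun x fun x => (φ x).re ^ 2 + (φ x).im ^ 2) (extChartAt (𝓡 m) x x) := by
    intro x
    set y := extChartAt (𝓡 m) x x with hy
    set G := coordMetric g x with hGdef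
    have hyt : y ∈ (extChartAt (𝓡 m) x).target := mem_extChartAt_target x
    have hG := fun i j => contDiffAt_coordMetric g x hyt i j
    have hpos := coordMetric_posDef g x hyt
    have hdet := hpos.det_pos
    have hc := contDiffAt_coordFun hφ x hyt
    have hr := contDiffAt_coordFun hre x hyt
    have hs := contDiffAt_coordFun him x hyt
    set r : (𝔼 m) → ℝ := coordFun x fun x => (φ x).re with hrdef
    set s : (𝔼 m) → ℝ := coordFun x fun x => (φ x).im with hsdef
    have hry : r y = (φ x).re := by simp only [hrdef, coordFun, hy, extChartAt_to_inv]
    have hsy : s y = (φ x).im := by simp only [hsdef, coordFun, hy, extChartAt_to_inv]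
    have hLr : coordLaplacian G r y = -lam * r y := by
      have h1 : coordLaplacian G r y = Complex.reCLM (coordLaplacian G (coordFun x φ) y) :=
        coordLaplacian_clm_comp hG hdet Complex.reCLM hc
      have h2 : coordLaplacian G (coordFun x φ) y = -(lam : ℂ) * φ x := hτ x
      rw [h2] at h1
      rw [hry]
      simpa using h1
    have hLs : coordLaplacian G s y = -lam * s y := by
      have h1 : coordLaplacian G s y = Complex.imCLM (coordLaplacian G (coordFun x φ) y) :=
        coordLaplacian_clm_comp hG hdet Complex.imCLM hc
      have h2 : coordLaplacian G (coordFun x φ) y = -(lam : ℂ) * φ x := hτ x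
      rw [h2] at h1
      rw [hsy]
      simpa using h1
    have hsq : ∀ v : (𝔼 m) → ℝ, ContDiffAt ℝ ∞ v y → coordLaplacian G (fun z => v z ^ 2) y
        = coordLaplacian G v y * (2 * v y) + gradInner G v v y * 2 := by
      intro v hv
      have h1 := coordLaplacian_scalar_comp hG hdet (f := fun t : ℝ => t ^ 2) (by fun_prop) hv
      have h2 : deriv (fun t : ℝ => t ^ 2) = fun t => 2 * t := by
        funext t
        simp
      have h3 : deriv (fun t : ℝ => 2 * t) (v y) = 2 := by
        simp
      rw [h1, h2, h3]
      rfl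
    have hsum : coordLaplacian G (coordFun x fun x => (φ x).re ^ 2 + (φ x).im ^ 2) y
        = coordLaplacian G r y * (2 * r y) + gradInner G r r y * 2
          + (coordLaplacian G s y * (2 * s y) + gradInner G s s y * 2) := by
      rw [← hsq r hr, ← hsq s hs, ← coordLaplacian_add hG hdet (hr.pow 2) (hs.pow 2)]
      rfl
    have hd : ∀ i, partialDeriv i (coordFun x φ) y
        = ((partialDeriv i r y : ℝ) : ℂ) + ((partialDeriv i s y : ℝ) : ℂ) * Complex.I := by
      intro i
      have h1 := partialDeriv_clm_comp Complex.reCLM (differentiableAt_of_smooth hc) i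
      have h2 := partialDeriv_clm_comp Complex.imCLM (differentiableAt_of_smooth hc) i
      have h3 : partialDeriv i r y = (partialDeriv i (coordFun x φ) y).re := h1
      have h4 : partialDeriv i s y = (partialDeriv i (coordFun x φ) y).im := h2
      rw [h3, h4, Complex.re_add_im]
    have hconf : conformality g φ φ x = ((gradInner G r r y - gradInner G s s y : ℝ) : ℂ)
        + ((gradInner G r s y + gradInner G s r y : ℝ) : ℂ) * Complex.I := by
      simp only [conformality, gradInner, ← hy, ← hGdef, hd]
      push_cast
      rw [← Finset.sum_sub_distrib, ← Finset.sum_add_distrib, Finset.sum_mul,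
        ← Finset.sum_add_distrib]
      refine Finset.sum_congr rfl fun i _ => ?_
      rw [← Finset.sum_sub_distrib, ← Finset.sum_add_distrib, Finset.sum_mul,
        ← Finset.sum_add_distrib]
      refine Finset.sum_congr rfl fun j _ => ?_
      ring_nf
      rw [Complex.I_sq]
      ring
    have hκx := hconf.symm.trans (hκ x)
    obtain ⟨n, D, hD⟩ := gradInner_eq_sum (G := G) hpos
    have hcomm : gradInner G s r y = gradInner G r s y := by
      rw [hD, hD]
      exact Finset.sum_congr rfl fun k _ => mul_comm _ _
    have h1 := congrArg Complex.re hκx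
    have h2 := congrArg Complex.im hκx
    simp [hcomm] at h1 h2
    have hP : 0 ≤ gradInner G r r y := by
      rw [hD]; exact Finset.sum_nonneg fun k _ => mul_self_nonneg _
    have hQ : 0 ≤ gradInner G s s y := by
      rw [hD]; exact Finset.sum_nonneg fun k _ => mul_self_nonneg _
    have hR : gradInner G r s y ^ 2 ≤ gradInner G r r y * gradInner G s s y := by
      rw [hD, hD, hD]
      simpa only [pow_two] using
        Finset.sum_mul_sq_le_sq_mul_sq Finset.univ (fun k => D k r) (fun k => D k s)
    have h3 := eigen_energy_bound (lam := lam) (p := r y) (q := s y) hP hQ hR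
      (by rw [hry, hsy]; linarith) (by rw [hry, hsy]; linarith)
    -- The goal is now twice the difference of the two sides of `h3`.
    rw [hsum, hLr, hLs]
    nlinarith
  have h := eq_of_subharmonic g hu key p q
  have hn : ∀ z : ℂ, ‖z‖ ^ 2 = z.re ^ 2 + z.im ^ 2 := fun z => by
    rw [Complex.sq_norm, Complex.normSq_apply]; ring
  rw [← hn, ← hn] at h
  exact (sq_eq_sq₀ (norm_nonneg _) (norm_nonneg _)).1 h

end EigenfunctionNorm

/-! ### Linear algebra of Riemannian submersions -/

section HorizontalIsometry

open Matrix

variable {m k : ℕ}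

/-- A linear map `Θ : (ℝᵐ, G) → (ℝᵏ, A⁻¹)` is surjective and isometric on the orthogonal
complement of its kernel if and only if `Θ G⁻¹ Θᵀ = A`. -/
lemma surjective_and_isometry_iff {G : Matrix (Fin m) (Fin m) ℝ} (hG : G.PosDef)
    {A : Matrix (Fin k) (Fin k) ℝ} (hA : A.PosDef) (T : Matrix (Fin k) (Fin m) ℝ) :
    (Function.Surjective T.mulVec ∧ ∀ v w : Fin m → ℝ,
      (∀ u, T *ᵥ u = 0 → u ⬝ᵥ G *ᵥ v = 0) → (∀ u, T *ᵥ u = 0 → u ⬝ᵥ G *ᵥ w = 0) →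
      (T *ᵥ v) ⬝ᵥ A⁻¹ *ᵥ (T *ᵥ w) = v ⬝ᵥ G *ᵥ w) ↔ T * G⁻¹ * Tᵀ = A := by
  have hGu : IsUnit G.det := isUnit_iff_ne_zero.2 hG.det_pos.ne'
  have hAu : IsUnit A.det := isUnit_iff_ne_zero.2 hA.det_pos.ne'
  have hGs : Gᵀ = G := hG.isHermitian
  have hGG : ∀ v, G *ᵥ (G⁻¹ *ᵥ v) = v := fun v => by
    rw [mulVec_mulVec, mul_nonsing_inv _ hGu, one_mulVec]
  have hpair : ∀ (v : Fin m → ℝ) (s : Fin k → ℝ), v ⬝ᵥ Tᵀ *ᵥ s = (T *ᵥ v) ⬝ᵥ s := fun v s => by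
    rw [mulVec_transpose, dotProduct_comm v, ← dotProduct_mulVec, dotProduct_comm]
  -- Metric duals G⁻¹Tᵀs of pulled-back covectors are horizontal; both directions test the
  -- conditions on them.
  have hhor : ∀ (s : Fin k → ℝ) u, T *ᵥ u = 0 → u ⬝ᵥ G *ᵥ (G⁻¹ *ᵥ (Tᵀ *ᵥ s)) = 0 := by
    intro s u hu
    rw [hGG, hpair, hu, zero_dotProduct]
  constructor
  · rintro ⟨hsurj, hiso⟩
    set S := T * G⁻¹ * Tᵀ with hS
    have hSv : ∀ s, S *ᵥ s = T *ᵥ (G⁻¹ *ᵥ (Tᵀ *ᵥ s)) := fun s => by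
      rw [hS, ← mulVec_mulVec, ← mulVec_mulVec]
    have h1 : ∀ s t, (S *ᵥ s) ⬝ᵥ A⁻¹ *ᵥ (S *ᵥ t) = (S *ᵥ s) ⬝ᵥ t := by
      intro s t
      rw [hSv, hSv, hiso _ _ (hhor s) (hhor t), hGG, hpair]
    -- If Ss = 0, then Tᵀs has zero G⁻¹-norm and vanishes, so s is orthogonal to the range of T,
    -- which is everything.
    have hinj : Function.Injective S.mulVec := by
      rw [← coe_mulVecLin, ← LinearMap.ker_eq_bot, LinearMap.ker_eq_bot']
      intro s hs
      have hs' : S *ᵥ s = 0 := hs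
      have h2 : Tᵀ *ᵥ s = 0 := by
        by_contra hne
        have h3 := hG.inv.dotProduct_mulVec_pos hne
        have h4 : star (Tᵀ *ᵥ s) ⬝ᵥ G⁻¹ *ᵥ (Tᵀ *ᵥ s) = 0 := by
          rw [star_trivial, dotProduct_comm, hpair, ← hSv, hs', zero_dotProduct]
        rw [h4] at h3
        exact lt_irrefl _ h3
      obtain ⟨v, hv⟩ := hsurj s
      have h5 : s ⬝ᵥ s = 0 := by
        nth_rewrite 1 [← hv]
        rw [← hpair, h2, dotProduct_zero]
      exact dotProduct_self_eq_zero.1 h5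
    have hSu : IsUnit S := mulVec_injective_iff_isUnit.1 hinj
    have hSsurj : Function.Surjective S.mulVec := mulVec_surjective_iff_isUnit.2 hSu
    -- Identity `h1` tests A⁻¹St against the range of S, which is the whole space.
    have h6 : ∀ t, A⁻¹ *ᵥ (S *ᵥ t) = t := by
      intro t
      refine dotProduct_eq _ _ fun r => ?_
      obtain ⟨s, rfl⟩ := hSsurj r
      rw [dotProduct_comm, h1, dotProduct_comm]
    refine ext_of_mulVec_single fun i => ?_
    have h7 := congrArg (A *ᵥ ·) (h6 (Pi.single i 1))
    simpa only [mulVec_mulVec, ← mul_assoc, mul_nonsing_inv _ hAu, one_mul] using h7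
  · intro hS
    have hSv : ∀ s, T *ᵥ (G⁻¹ *ᵥ (Tᵀ *ᵥ s)) = A *ᵥ s := fun s => by
      rw [← hS, ← mulVec_mulVec, ← mulVec_mulVec]
    have hAA : ∀ s, A *ᵥ (A⁻¹ *ᵥ s) = s := fun s => by
      rw [mulVec_mulVec, mul_nonsing_inv _ hAu, one_mulVec]
    refine ⟨fun t => ⟨G⁻¹ *ᵥ (Tᵀ *ᵥ (A⁻¹ *ᵥ t)), by rw [hSv, hAA]⟩, fun v w hv _ => ?_⟩
    -- The horizontal lift of Tv. The difference v - v' is both vertical and horizontal, hence zero.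
    set v' := G⁻¹ *ᵥ (Tᵀ *ᵥ (A⁻¹ *ᵥ (T *ᵥ v))) with hv'
    have hker : T *ᵥ (v - v') = 0 := by rw [mulVec_sub, hv', hSv, hAA, sub_self]
    have h1 : v = v' := by
      by_contra hne
      have h2 := hG.dotProduct_mulVec_pos (sub_ne_zero.2 hne)
      have h3 : star (v - v') ⬝ᵥ G *ᵥ (v - v') = 0 := by
        rw [star_trivial, mulVec_sub, dotProduct_sub, hv _ hker, hv', hhor _ _ hker, sub_zero]
      rw [h3] at h2
      exact lt_irrefl _ h2
    have h4 : G *ᵥ v = Tᵀ *ᵥ (A⁻¹ *ᵥ (T *ᵥ v)) := by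
      conv_lhs => rw [h1, hv', hGG]
    have h5 : v ⬝ᵥ G *ᵥ w = w ⬝ᵥ G *ᵥ v := by
      rw [dotProduct_mulVec, dotProduct_comm, ← mulVec_transpose, hGs]
    have hAs : (A⁻¹)ᵀ = A⁻¹ := hA.inv.isHermitian
    rw [h5, h4, hpair, dotProduct_mulVec, dotProduct_comm (T *ᵥ w), ← mulVec_transpose, hAs]

end HorizontalIsometry

/-! ### Local angles of functions of constant modulus -/

section Angle

variable {m : ℕ} {M : Type*} [TopologicalSpace M]
  [ChartedSpace (EuclideanSpace ℝ (Fin m)) M]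

/-- The angle of a function relative to its value at `x`, in the preferred chart around `x`. -/
def angle (φ : M → ℂ) (x : M) (y : 𝔼 m) : ℝ :=
  Complex.arg (coordFun x φ y / φ x)

variable {φ ψ : M → ℂ}

lemma coordFun_center {F : Type*} (f : M → F) (x : M) :
    coordFun (m := m) x f (extChartAt (𝓡 m) x x) = f x := by
  simp only [coordFun, extChartAt_to_inv]

/-- A function of constant modulus is recovered from its angle. -/
lemma coordFun_eq_exp_angle (hc : ∀ p q, ‖φ p‖ = ‖φ q‖) {x : M} (h0 : φ x ≠ 0) (y : 𝔼 m) :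
    coordFun x φ y = φ x * Complex.exp (angle φ x y * Complex.I) := by
  have h1 : ‖coordFun x φ y / φ x‖ = 1 := by
    rw [norm_div, coordFun, hc _ x, div_self (norm_ne_zero_iff.2 h0)]
  have h2 := Complex.norm_mul_exp_arg_mul_I (coordFun x φ y / φ x)
  rw [h1, Complex.ofReal_one, one_mul] at h2
  rw [angle, h2, mul_div_cancel₀ _ h0]

lemma angle_center {x : M} (h0 : φ x ≠ 0) : angle (m := m) φ x (extChartAt (𝓡 m) x x) = 0 := by
  rw [angle, coordFun_center, div_self h0, Complex.arg_one]

variable [IsManifold (𝓡 m) ∞ M]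

/-- Normalizing by φ(x) puts the quotient at 1 at the centre, away from the branch cut, and the
argument is the imaginary part of the logarithm. -/
lemma contDiffAt_angle (hφ : ContMDiff (𝓡 m) 𝓘(ℝ, ℂ) ∞ φ) {x : M} (h0 : φ x ≠ 0) :
    ContDiffAt ℝ ∞ (angle (m := m) φ x) (extChartAt (𝓡 m) x x) := by
  have h1 : ContDiffAt ℝ ∞ (fun y : 𝔼 m => coordFun x φ y / φ x) (extChartAt (𝓡 m) x x) :=
    (contDiffAt_coordFun hφ x (mem_extChartAt_target x)).div_const _
  have h2 : coordFun (m := m) x φ (extChartAt (𝓡 m) x x) / φ x = 1 := by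
    rw [coordFun_center, div_self h0]
  have h3 : ContDiffAt ℝ ∞ Complex.log (coordFun (m := m) x φ (extChartAt (𝓡 m) x x) / φ x) := by
    rw [h2]
    exact (Complex.contDiffAt_log Complex.one_mem_slitPlane).restrict_scalars ℝ
  have h4 := Complex.imCLM.contDiff.contDiffAt.comp (extChartAt (𝓡 m) x x)
    (ContDiffAt.comp (f := fun y : 𝔼 m => coordFun x φ y / φ x) (extChartAt (𝓡 m) x x) h3 h1)
  refine h4.congr_of_eventuallyEq (Eventually.of_forall fun y => ?_)
  simp [angle, Complex.log_im]

lemma hasDerivAt_mul_exp (c : ℂ) (t : ℝ) :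
    HasDerivAt (fun t : ℝ => c * Complex.exp (t * Complex.I))
      (c * Complex.I * Complex.exp (t * Complex.I)) t := by
  have h := (((hasDerivAt_id t).ofReal_comp.mul_const Complex.I).cexp).const_mul c
  exact h.congr_deriv (by simp; ring)

lemma contDiff_mul_exp (c : ℂ) : ContDiff ℝ ∞ (fun t : ℝ => c * Complex.exp (t * Complex.I)) :=
  contDiff_const.mul ((Complex.ofRealCLM.contDiff.mul contDiff_const).cexp)

lemma partialDeriv_coordFun (hφ : ContMDiff (𝓡 m) 𝓘(ℝ, ℂ) ∞ φ) (hc : ∀ p q, ‖φ p‖ = ‖φ q‖) {x : M}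
    (h0 : φ x ≠ 0) (i : Fin m) :
    partialDeriv i (coordFun x φ) (extChartAt (𝓡 m) x x)
      = ((partialDeriv i (angle φ x) (extChartAt (𝓡 m) x x) : ℝ) : ℂ) * (φ x * Complex.I) := by
  have h1 : coordFun (m := m) x φ = fun y => φ x * Complex.exp (angle φ x y * Complex.I) :=
    funext (coordFun_eq_exp_angle hc h0)
  rw [h1, partialDeriv_scalar_comp (hasDerivAt_mul_exp _ _).differentiableAt
    (differentiableAt_of_smooth (contDiffAt_angle hφ h0)), (hasDerivAt_mul_exp _ _).deriv,
    angle_center h0]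
  simp

lemma conformality_eq_angle (g : SmoothMetric m M) (hφ : ContMDiff (𝓡 m) 𝓘(ℝ, ℂ) ∞ φ)
    (hψ : ContMDiff (𝓡 m) 𝓘(ℝ, ℂ) ∞ ψ) (hcφ : ∀ p q, ‖φ p‖ = ‖φ q‖)
    (hcψ : ∀ p q, ‖ψ p‖ = ‖ψ q‖) {x : M} (hφ0 : φ x ≠ 0) (hψ0 : ψ x ≠ 0) :
    conformality g φ ψ x = -((gradInner (coordMetric g x) (angle φ x) (angle ψ x)
      (extChartAt (𝓡 m) x x) : ℝ) : ℂ) * (φ x * ψ x) := by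
  simp only [conformality, gradInner, partialDeriv_coordFun hφ hcφ hφ0,
    partialDeriv_coordFun hψ hcψ hψ0]
  push_cast
  rw [← Finset.sum_neg_distrib, Finset.sum_mul]
  refine Finset.sum_congr rfl fun i _ => ?_
  rw [← Finset.sum_neg_distrib, Finset.sum_mul]
  refine Finset.sum_congr rfl fun j _ => ?_
  linear_combination (((coordMetric g x (extChartAt (𝓡 m) x x))⁻¹ i j : ℝ) : ℂ)
    * ((partialDeriv i (angle φ x) (extChartAt (𝓡 m) x x) : ℝ) : ℂ)
    * ((partialDeriv j (angle ψ x) (extChartAt (𝓡 m) x x) : ℝ) : ℂ) * φ x * ψ x * Complex.I_sq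

/-- The chain rule for t ↦ φ(x) exp(it), whose first and second derivatives at the central angle 0
are iφ(x) and -φ(x). -/
lemma laplaceBeltrami_eq_angle (g : SmoothMetric m M) (hφ : ContMDiff (𝓡 m) 𝓘(ℝ, ℂ) ∞ φ)
    (hc : ∀ p q, ‖φ p‖ = ‖φ q‖) {x : M} (h0 : φ x ≠ 0) :
    laplaceBeltrami g φ x
      = (((coordLaplacian (coordMetric g x) (angle φ x) (extChartAt (𝓡 m) x x) : ℝ) : ℂ) * Complex.I
        - ((gradInner (coordMetric g x) (angle φ x) (angle φ x) (extChartAt (𝓡 m) x x) : ℝ) : ℂ))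
        * φ x := by
  have h1 : coordFun (m := m) x φ = fun y => φ x * Complex.exp (angle φ x y * Complex.I) :=
    funext (coordFun_eq_exp_angle hc h0)
  have ht := mem_extChartAt_target (I := 𝓡 m) x
  have h2 : deriv (fun t : ℝ => φ x * Complex.exp (t * Complex.I))
      = fun t : ℝ => φ x * Complex.I * Complex.exp (t * Complex.I) :=
    funext fun t => (hasDerivAt_mul_exp _ t).deriv
  have h3 : laplaceBeltrami g φ x
      = coordLaplacian (coordMetric g x) (coordFun x φ) (extChartAt (𝓡 m) x x) := rfl
  rw [h3, h1, coordLaplacian_scalar_comp (fun i j => contDiffAt_coordMetric g x ht i j)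
    (coordMetric_posDef g x ht).det_pos (contDiff_mul_exp (φ x)) (contDiffAt_angle hφ h0), h2,
    (hasDerivAt_mul_exp _ _).deriv, angle_center h0]
  simp only [Complex.ofReal_zero, zero_mul, Complex.exp_zero, mul_one, Complex.real_smul]
  linear_combination ((gradInner (coordMetric g x) (angle φ x) (angle φ x)
    (extChartAt (𝓡 m) x x) : ℝ) : ℂ) * φ x * Complex.I_sq

end Angle

/-! ### Differentials and metrics at the centre of a chart -/

section Submersion

variable {m k : ℕ} {M : Type*} [TopologicalSpace M]
  [ChartedSpace (EuclideanSpace ℝ (Fin m)) M]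
  {N : Type*} [TopologicalSpace N] [ChartedSpace (EuclideanSpace ℝ (Fin k)) N]

lemma contDiffAt_coordMap {f : M → N} (hf : ContMDiff (𝓡 m) (𝓡 k) ∞ f) (x : M) :
    ContDiffAt ℝ ∞ (coordMap (m := m) (n := k) f x) (extChartAt (𝓡 m) x x) := by
  have h := (contMDiffAt_iff.1 (hf x)).2
  rw [modelWithCornersSelf_coe, Set.range_id, contDiffWithinAt_univ] at h
  exact h

lemma mfderiv_eq_fderiv_coordMap {f : M → N} (hf : ContMDiff (𝓡 m) (𝓡 k) ∞ f) (x : M) :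
    (mfderiv (𝓡 m) (𝓡 k) f x : (𝔼 m) →L[ℝ] (𝔼 k))
      = fderiv ℝ (coordMap f x) (extChartAt (𝓡 m) x x) := by
  have h := (hf.mdifferentiableAt (by simp) : MDifferentiableAt (𝓡 m) (𝓡 k) f x).mfderiv
  rw [modelWithCornersSelf_coe, Set.range_id, fderivWithin_univ] at h
  exact h

lemma ofLp_fderiv {Φ : (𝔼 m) → 𝔼 k} {y : 𝔼 m} (hΦ : DifferentiableAt ℝ Φ y) (v : 𝔼 m) :
    (fderiv ℝ Φ y v).ofLp = (jacobian Φ y).mulVec v.ofLp := by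
  funext i
  rw [fderiv_apply_eq_sum (fderiv ℝ Φ y) v]
  simp only [WithLp.ofLp_sum, WithLp.ofLp_smul, Finset.sum_apply, Pi.smul_apply, smul_eq_mul,
    Matrix.mulVec, dotProduct]
  refine Finset.sum_congr rfl fun a _ => ?_
  rw [mul_comm]
  congr 1
  exact (partialDeriv_clm_comp (EuclideanSpace.proj i : (𝔼 k) →L[ℝ] ℝ) hΦ a).symm

/-- A smooth map from a compact manifold to a connected Hausdorff manifold is onto if its
differentials are. -/
theorem surjective_of_surjective_mfderiv [CompactSpace M] [Nonempty M] [T2Space N]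
    [PreconnectedSpace N] {f : M → N} (hf : ContMDiff (𝓡 m) (𝓡 k) ∞ f)
    (h : ∀ x, Function.Surjective (mfderiv (𝓡 m) (𝓡 k) f x)) : Function.Surjective f := by
  rw [← Set.range_eq_univ]
  -- The image is compact, hence closed. It is open because a map with surjective strict derivative
  -- sends neighbourhoods onto neighbourhoods.
  refine IsClopen.eq_univ ⟨(isCompact_range hf.continuous).isClosed, ?_⟩ (Set.range_nonempty f)
  rw [isOpen_iff_mem_nhds]
  rintro _ ⟨x, rfl⟩
  set y := extChartAt (𝓡 m) x x with hy
  have hs : HasStrictFDerivAt (coordMap (m := m) (n := k) f x) (fderiv ℝ (coordMap (m := m) (n := k) f x) y) y :=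
    (contDiffAt_coordMap hf x).hasStrictFDerivAt (by simp)
  have hsurj : (fderiv ℝ (coordMap (m := m) (n := k) f x) y).range = ⊤ := by
    rw [LinearMap.range_eq_top]
    have := h x
    intro v
    obtain ⟨w, hw⟩ := this v
    refine ⟨w, ?_⟩
    have h1 := congrArg (fun L : (𝔼 m) →L[ℝ] (𝔼 k) => L w) (mfderiv_eq_fderiv_coordMap hf x)
    exact h1.symm.trans hw
  have hmap := hs.map_nhds_eq_of_surj hsurj
  have hsymm : (extChartAt (𝓡 m) x).symm y = x := extChartAt_to_inv x
  have hcont : ContinuousAt (fun z => f ((extChartAt (𝓡 m) x).symm z)) y := by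
    have h1 : ContinuousAt (extChartAt (𝓡 m) x).symm y := continuousAt_extChartAt_symm x
    exact hf.continuous.continuousAt.comp h1
  -- The target chart is injective only on its source, so the points z must be kept where f lands in
  -- that source.
  have hU : ∀ᶠ z in 𝓝 y, f ((extChartAt (𝓡 m) x).symm z) ∈ (extChartAt (𝓡 k) (f x)).source := by
    refine hcont.eventually ((isOpen_extChartAt_source (I := 𝓡 k) (f x)).eventually_mem ?_)
    simp only [hsymm]
    exact mem_extChartAt_source (f x)
  have himg := Filter.image_mem_map (m := coordMap (m := m) (n := k) f x) hU
  rw [hmap] at himg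
  have hyx : coordMap (m := m) (n := k) f x y = extChartAt (𝓡 k) (f x) (f x) := by
    simp only [coordMap, hsymm]
  rw [hyx] at himg
  filter_upwards [(continuousAt_extChartAt (I := 𝓡 k) (f x)).eventually himg,
    extChartAt_source_mem_nhds (I := 𝓡 k) (f x)] with q hq hqs
  obtain ⟨z, hz, hzq⟩ := hq
  exact ⟨_, (extChartAt (𝓡 k) (f x)).injOn hz hqs hzq⟩

variable [IsManifold (𝓡 m) ∞ M]

lemma coordVector_center (x : M) (i : Fin m) :
    (coordVector x (extChartAt (𝓡 m) x x) i : 𝔼 m) = EuclideanSpace.single i (1 : ℝ) := by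
  have h1 := coordVector_eq x (mem_extChartAt_target (I := 𝓡 m) x) i
  refine Eq.trans h1 ?_
  -- The base point of the coordinate vector equals x only propositionally, so it is generalized
  -- before substitution.
  have h2 : ∀ q, q = x → (chartTriv (m := m) x).symmL ℝ q
      (EuclideanSpace.single i (1 : ℝ) : 𝔼 m) = (EuclideanSpace.single i (1 : ℝ) : 𝔼 m) := by
    rintro q rfl
    rw [TangentBundle.symmL_trivializationAt_eq_core (mem_chart_source _ q)]
    exact (tangentBundleCore (𝓡 m) M).coordChange_self _ _ (mem_chart_source _ q) _
  exact h2 _ (extChartAt_to_inv x)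

lemma inner_eq_coordMetric (g : SmoothMetric m M) (x : M) (v w : 𝔼 m) :
    (g.inner x : (𝔼 m) →L[ℝ] (𝔼 m) →L[ℝ] ℝ) v w
      = v.ofLp ⬝ᵥ (coordMetric g x (extChartAt (𝓡 m) x x)).mulVec w.ofLp := by
  have hv : ∀ v : 𝔼 m, v = ∑ i, v i • (EuclideanSpace.single i (1 : ℝ) : 𝔼 m) := fun v =>
    fderiv_apply_eq_sum (ContinuousLinearMap.id ℝ (𝔼 m)) v
  have h1 : ∀ i j, coordMetric g x (extChartAt (𝓡 m) x x) i j
      = (g.inner x : (𝔼 m) →L[ℝ] (𝔼 m) →L[ℝ] ℝ) (EuclideanSpace.single i (1 : ℝ))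
        (EuclideanSpace.single j (1 : ℝ)) := by
    intro i j
    rw [← coordVector_center x i, ← coordVector_center x j]
    exact inner_congr_point g (extChartAt_to_inv x) _ _
  have h2 := inner_sum_smul g x v.ofLp w.ofLp
    (fun i => (EuclideanSpace.single i (1 : ℝ) : 𝔼 m))
    (fun i => (EuclideanSpace.single i (1 : ℝ) : 𝔼 m))
  have h3 : (g.inner x : (𝔼 m) →L[ℝ] (𝔼 m) →L[ℝ] ℝ) v w = ∑ i, ∑ j, v i * w j *
      (g.inner x : (𝔼 m) →L[ℝ] (𝔼 m) →L[ℝ] ℝ) (EuclideanSpace.single i (1 : ℝ))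
        (EuclideanSpace.single j (1 : ℝ)) := by
    conv_lhs => rw [hv v, hv w]
    exact h2
  rw [h3]
  simp only [dotProduct, Matrix.mulVec, Finset.mul_sum, h1]
  exact Finset.sum_congr rfl fun i _ => Finset.sum_congr rfl fun j _ => by ring

end Submersion

/-! ### Constant coefficients of the flat metric in angle coordinates -/

section FlatTorus

variable {k : ℕ}

namespace Torus

instance : T2Space (Torus k) := inferInstanceAs (T2Space (Fin k → Circle))

instance : PreconnectedSpace (Torus k) := inferInstanceAs (PreconnectedSpace (Fin k → Circle))

lemma matrixForm_eq_dotProduct (B : Matrix (Fin k) (Fin k) ℝ) (v w : 𝔼 k) :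
    matrixForm B v w = v.ofLp ⬝ᵥ B.mulVec w.ofLp := by
  rw [matrixForm_apply]
  simp only [dotProduct, Matrix.mulVec, Finset.mul_sum]
  exact Finset.sum_congr rfl fun i _ => Finset.sum_congr rfl fun j _ => by ring

lemma coordMetric_flatMetric {A : Matrix (Fin k) (Fin k) ℝ} (hA : A.PosDef) (p : Torus k)
    {y : 𝔼 k} (hy : y ∈ (extChartAt (𝓡 k) p).target) : coordMetric (flatMetric A hA) p y = A⁻¹ := by
  have hq : (extChartAt (𝓡 k) p).symm y ∈ (angleChart p).source := by
    have := (extChartAt (𝓡 k) p).map_target hy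
    rwa [extChartAt_source] at this
  have hv : ∀ i, (coordVector p y i : 𝔼 k) = EuclideanSpace.single i (1 : ℝ) := fun i => by
    refine Eq.trans (coordVector_eq p hy i) ?_
    rw [symmL_trivializationAt hq]
    rfl
  ext i j
  have h1 : coordMetric (flatMetric A hA) p y i j
      = matrixForm A⁻¹ (coordVector p y i : 𝔼 k) (coordVector p y j : 𝔼 k) := rfl
  rw [h1, hv, hv, matrixForm_eq_dotProduct]
  simp

lemma christoffel_flatMetric {A : Matrix (Fin k) (Fin k) ℝ} (hA : A.PosDef) (p : Torus k)
    (a b c : Fin k) :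
    christoffel (coordMetric (flatMetric A hA) p) (extChartAt (𝓡 k) p p) c a b = 0 := by
  have h1 : ∀ a b d, partialDeriv d (fun z => coordMetric (flatMetric A hA) p z a b)
      (extChartAt (𝓡 k) p p) = 0 := by
    intro a b d
    have h2 : (fun z => coordMetric (flatMetric A hA) p z a b)
        =ᶠ[𝓝 (extChartAt (𝓡 k) p p)] fun _ => A⁻¹ a b := by
      filter_upwards [(isOpen_extChartAt_target (I := 𝓡 k) p).mem_nhds (mem_extChartAt_target p)]
        with z hz
      rw [coordMetric_flatMetric hA p hz]
    rw [partialDeriv_congr h2, partialDeriv_const]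
  simp only [christoffel, h1]
  simp

end Torus

end FlatTorus

/-! ### The torus map expressed through angles -/

section AngleMap

variable {m k : ℕ} {M : Type*} [TopologicalSpace M]
  [ChartedSpace (EuclideanSpace ℝ (Fin m)) M]

variable {φ : Fin k → M → ℂ} {π : M → Torus k} {x₀ : M}

/-- The angle chart at π(x) takes the argument of a quotient, in which the normalization by |φᵢ(x₀)|
cancels; the base point x₀ thus plays no role locally. -/
lemma coordMap_eq_angle (hπ : ∀ x i, ((π x i : Circle) : ℂ) = φ i x / (‖φ i x₀‖ : ℂ))
    (h0 : ∀ i x, φ i x ≠ 0) (x : M) (y : 𝔼 m) (i : Fin k) :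
    coordMap (m := m) (n := k) π x y i = angle (φ i) x y := by
  have h1 : (‖φ i x₀‖ : ℂ) ≠ 0 := by exact_mod_cast norm_ne_zero_iff.2 (h0 i x₀)
  have h2 : coordMap (m := m) (n := k) π x y i = Complex.arg
      ((π ((extChartAt (𝓡 m) x).symm y) i / π x i : Circle) : ℂ) := rfl
  rw [h2, Circle.coe_div, hπ, hπ, div_div_div_cancel_right₀ h1]
  rfl

variable [IsManifold (𝓡 m) ∞ M]

lemma isRiemannianSubmersion_iff (g : SmoothMetric m M) {A : Matrix (Fin k) (Fin k) ℝ}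
    (hA : A.PosDef) (hπ : ContMDiff (𝓡 m) (𝓡 k) ∞ π) :
    IsRiemannianSubmersion g (Torus.flatMetric A hA) π ↔
      ∀ x, jacobian (coordMap (m := m) (n := k) π x) (extChartAt (𝓡 m) x x)
        * (coordMetric g x (extChartAt (𝓡 m) x x))⁻¹
        * (jacobian (coordMap (m := m) (n := k) π x) (extChartAt (𝓡 m) x x)).transpose = A := by
  have hT : ∀ (x : M) (v : 𝔼 m),
      (show 𝔼 k from mfderiv (𝓡 m) (𝓡 k) π x v).ofLp
        = (jacobian (coordMap (m := m) (n := k) π x) (extChartAt (𝓡 m) x x)).mulVec v.ofLp := by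
    intro x v
    have h1 := congrArg (fun L : (𝔼 m) →L[ℝ] (𝔼 k) => L v) (mfderiv_eq_fderiv_coordMap hπ x)
    rw [← ofLp_fderiv (differentiableAt_of_smooth (contDiffAt_coordMap hπ x))]
    exact congrArg WithLp.ofLp h1
  have hT0 : ∀ (x : M) (v : 𝔼 m), mfderiv (𝓡 m) (𝓡 k) π x v = 0 ↔
      (jacobian (coordMap (m := m) (n := k) π x) (extChartAt (𝓡 m) x x)).mulVec v.ofLp = 0 := by
    intro x v
    rw [← hT x v]
    exact ⟨fun h => congrArg WithLp.ofLp h, fun h => (WithLp.ofLp_injective 2) h⟩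
  have hI : ∀ (x : M) (v w : 𝔼 m), (Torus.flatMetric A hA).inner (π x)
      (mfderiv (𝓡 m) (𝓡 k) π x v) (mfderiv (𝓡 m) (𝓡 k) π x w)
      = (jacobian (coordMap (m := m) (n := k) π x) (extChartAt (𝓡 m) x x)).mulVec v.ofLp ⬝ᵥ A⁻¹.mulVec
        ((jacobian (coordMap (m := m) (n := k) π x) (extChartAt (𝓡 m) x x)).mulVec w.ofLp) := by
    intro x v w
    rw [← hT x v, ← hT x w]
    exact Torus.matrixForm_eq_dotProduct A⁻¹ _ _
  constructor
  · intro h x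
    rw [← surjective_and_isometry_iff
      (coordMetric_posDef g x (mem_extChartAt_target x)) hA]
    refine ⟨fun t => ?_, fun v w hv hw => ?_⟩
    · obtain ⟨v, hv⟩ := h.surjective_mfderiv x (WithLp.toLp 2 t : 𝔼 k)
      refine ⟨(v : 𝔼 m).ofLp, ?_⟩
      rw [← hT x v]
      exact congrArg WithLp.ofLp hv
    · have h1 := h.isometry_horizontal x (WithLp.toLp 2 v : 𝔼 m) (WithLp.toLp 2 w : 𝔼 m)
        (fun u hu => (inner_eq_coordMetric g x u _).trans (hv _ ((hT0 x u).1 hu)))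
        (fun u hu => (inner_eq_coordMetric g x u _).trans (hw _ ((hT0 x u).1 hu)))
      exact (hI x _ _).symm.trans (h1.trans (inner_eq_coordMetric g x _ _))
  · intro h
    have h' := fun x => (surjective_and_isometry_iff
      (coordMetric_posDef g x (mem_extChartAt_target x)) hA _).2 (h x)
    refine ⟨hπ, fun x t => ?_, fun x v w hv hw => ?_⟩
    · obtain ⟨v, hv⟩ := (h' x).1 (t : 𝔼 k).ofLp
      refine ⟨(WithLp.toLp 2 v : 𝔼 m), WithLp.ofLp_injective 2 ?_⟩
      exact (hT x (WithLp.toLp 2 v)).trans hv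
    · have h1 := (h' x).2 (v : 𝔼 m).ofLp (w : 𝔼 m).ofLp
        (fun u hu => (inner_eq_coordMetric g x (WithLp.toLp 2 u) v).symm.trans
          (hv _ ((hT0 x (WithLp.toLp 2 u)).2 hu)))
        (fun u hu => (inner_eq_coordMetric g x (WithLp.toLp 2 u) w).symm.trans
          (hw _ ((hT0 x (WithLp.toLp 2 u)).2 hu)))
      exact (hI x v w).trans (h1.trans (inner_eq_coordMetric g x v w).symm)

lemma contMDiff_angleMap (hφ : ∀ i, ContMDiff (𝓡 m) 𝓘(ℝ, ℂ) ∞ (φ i))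
    (hπ : ∀ x i, ((π x i : Circle) : ℂ) = φ i x / (‖φ i x₀‖ : ℂ)) (h0 : ∀ i x, φ i x ≠ 0) :
    ContMDiff (𝓡 m) (𝓡 k) ∞ π := by
  intro x
  rw [contMDiffAt_iff]
  constructor
  · have h1 : Continuous (show M → Fin k → Circle from π) := by
      refine continuous_pi fun i => continuous_induced_rng.2 ?_
      have h2 : (fun x => φ i x / (‖φ i x₀‖ : ℂ)) = fun x => ((π x i : Circle) : ℂ) :=
        funext fun x => (hπ x i).symm
      have h3 : Continuous fun x => φ i x / (‖φ i x₀‖ : ℂ) := (hφ i).continuous.div_const _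
      rw [h2] at h3
      exact h3
    exact Continuous.continuousAt h1
  · rw [modelWithCornersSelf_coe, Set.range_id, contDiffWithinAt_univ]
    have h1 : ContDiffAt ℝ ∞ (coordMap (m := m) (n := k) π x) (extChartAt (𝓡 m) x x) := by
      rw [contDiffAt_euclidean]
      intro i
      refine (contDiffAt_angle (hφ i) (h0 i x)).congr_of_eventuallyEq
        (Eventually.of_forall fun y => coordMap_eq_angle hπ h0 x y i)
    exact h1

/-- The Christoffel symbols of the flat metric vanish, so harmonicity decouples into harmonicity of
each angle. -/
lemma tensionField_angleMap (g : SmoothMetric m M) {A : Matrix (Fin k) (Fin k) ℝ} (hA : A.PosDef)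
    (hπ : ∀ x i, ((π x i : Circle) : ℂ) = φ i x / (‖φ i x₀‖ : ℂ)) (h0 : ∀ i x, φ i x ≠ 0)
    (x : M) (c : Fin k) :
    tensionField g (Torus.flatMetric A hA) π x c
      = coordLaplacian (coordMetric g x) (angle (φ c) x) (extChartAt (𝓡 m) x x) := by
  have h1 : (fun y => coordMap (m := m) (n := k) π x y c) = angle (φ c) x :=
    funext fun y => coordMap_eq_angle hπ h0 x y c
  simp only [tensionField, Torus.christoffel_flatMetric, h1, mul_zero, zero_mul,
    Finset.sum_const_zero, add_zero]

lemma gram_angleMap (g : SmoothMetric m M)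
    (hπ : ∀ x i, ((π x i : Circle) : ℂ) = φ i x / (‖φ i x₀‖ : ℂ)) (h0 : ∀ i x, φ i x ≠ 0) (x : M)
    (i j : Fin k) :
    (jacobian (coordMap π x) (extChartAt (𝓡 m) x x) * (coordMetric g x (extChartAt (𝓡 m) x x))⁻¹
        * (jacobian (coordMap π x) (extChartAt (𝓡 m) x x)).transpose) i j
      = gradInner (coordMetric g x) (angle (φ i) x) (angle (φ j) x) (extChartAt (𝓡 m) x x) := by
  have h1 : ∀ c, (fun y => coordMap (m := m) (n := k) π x y c) = angle (φ c) x := fun c =>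
    funext fun y => coordMap_eq_angle hπ h0 x y c
  simp only [Matrix.mul_apply, Matrix.transpose_apply, jacobian, Matrix.of_apply, h1, gradInner,
    Finset.sum_mul]
  rw [Finset.sum_comm]
  exact Finset.sum_congr rfl fun a _ => Finset.sum_congr rfl fun b _ => by ring

lemma posSemidef_gram (g : SmoothMetric m M) (x : M) (θ : Fin k → (𝔼 m) → ℝ) :
    (Matrix.of fun i j => gradInner (coordMetric g x) (θ i) (θ j)
      (extChartAt (𝓡 m) x x)).PosSemidef := by
  have h1 := (coordMetric_posDef g x (mem_extChartAt_target x)).inv.posSemidef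
  set J : Matrix (Fin k) (Fin m) ℝ :=
    Matrix.of fun i a => partialDeriv a (θ i) (extChartAt (𝓡 m) x x) with hJ
  suffices h2 : (Matrix.of fun i j => gradInner (coordMetric g x) (θ i) (θ j)
      (extChartAt (𝓡 m) x x))
      = J * (coordMetric g x (extChartAt (𝓡 m) x x))⁻¹ * J.conjTranspose by
    rw [h2]
    exact h1.mul_mul_conjTranspose_same J
  ext i j
  simp only [Matrix.of_apply, Matrix.mul_apply, Matrix.conjTranspose_apply, star_trivial, hJ,
    gradInner, Finset.sum_mul]
  rw [Finset.sum_comm]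
  exact Finset.sum_congr rfl fun a _ => Finset.sum_congr rfl fun b _ => by ring

lemma nondegenerate_neg_ofReal_iff {A : Matrix (Fin k) (Fin k) ℝ} :
    (Matrix.of fun i j => -(A i j : ℂ)).Nondegenerate ↔ A.det ≠ 0 := by
  have h1 : (Matrix.of fun i j => -(A i j : ℂ)) = -(Complex.ofRealHom.mapMatrix A) := by
    ext i j
    simp
  rw [Matrix.nondegenerate_iff_det_ne_zero, h1, Matrix.det_neg, ← RingHom.map_det]
  simp

end AngleMap

/-! ### Eigenfamilies and angles; the theorem -/

section Main

section ConstantModulus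

variable {k : ℕ} {M : Type*} {φ : Fin k → M → ℂ}

lemma ne_zero_of_norm_eq (hφ0 : ∀ i, ∃ x, φ i x ≠ 0) (hc : ∀ i p q, ‖φ i p‖ = ‖φ i q‖)
    (i : Fin k) (x : M) : φ i x ≠ 0 := by
  obtain ⟨p, hp⟩ := hφ0 i
  rw [← norm_ne_zero_iff, hc i x p]
  exact norm_ne_zero_iff.2 hp

/-- The map to the torus given by functions of constant modulus. -/
lemma exists_angleMap (hc : ∀ i p q, ‖φ i p‖ = ‖φ i q‖) (h0 : ∀ i x, φ i x ≠ 0) (x₀ : M) :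
    ∃ π : M → Torus k, ∀ x i, ((π x i : Circle) : ℂ) = φ i x / (‖φ i x₀‖ : ℂ) := by
  refine ⟨fun x i => ⟨φ i x / (‖φ i x₀‖ : ℂ), ?_⟩, fun x i => rfl⟩
  refine mem_sphere_zero_iff_norm.2 ?_
  rw [norm_div, hc i x x₀, Complex.norm_real, norm_norm,
    div_self (norm_ne_zero_iff.2 (h0 i x₀))]

end ConstantModulus

variable {m k : ℕ} {M : Type*} [TopologicalSpace M]
  [ChartedSpace (EuclideanSpace ℝ (Fin m)) M] [IsManifold (𝓡 m) ∞ M]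

variable {A : Matrix (Fin k) (Fin k) ℝ} {φ : Fin k → M → ℂ}

lemma norm_eq_of_eigenfamily [CompactSpace M] [ConnectedSpace M] {g : SmoothMetric m M}
    (hφ : ∀ i, ContMDiff (𝓡 m) 𝓘(ℝ, ℂ) ∞ (φ i))
    (h : IsEigenfamily g (fun i => -(A i i : ℂ)) (Matrix.of fun i j => -(A i j : ℂ)) φ)
    (i : Fin k) (p q : M) : ‖φ i p‖ = ‖φ i q‖ :=
  norm_eq_of_eigenfunction g (hφ i) (fun x => h.2 i x) (fun x => h.1 i i x) p q

/-- For functions of constant modulus, being an eigenfamily is a condition on the angles. -/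
lemma isEigenfamily_iff_angle (g : SmoothMetric m M) (hφ : ∀ i, ContMDiff (𝓡 m) 𝓘(ℝ, ℂ) ∞ (φ i))
    (hc : ∀ i p q, ‖φ i p‖ = ‖φ i q‖) (h0 : ∀ i x, φ i x ≠ 0) :
    IsEigenfamily g (fun i => -(A i i : ℂ)) (Matrix.of fun i j => -(A i j : ℂ)) φ ↔
      (∀ i j x, gradInner (coordMetric g x) (angle (φ i) x) (angle (φ j) x)
        (extChartAt (𝓡 m) x x) = A i j) ∧
      ∀ i x, coordLaplacian (coordMetric g x) (angle (φ i) x) (extChartAt (𝓡 m) x x) = 0 := by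
  have h1 : (∀ i j x, conformality g (φ i) (φ j) x
      = (Matrix.of fun i j => -(A i j : ℂ)) i j * (φ i x * φ j x)) ↔
      ∀ i j x, gradInner (coordMetric g x) (angle (φ i) x) (angle (φ j) x)
        (extChartAt (𝓡 m) x x) = A i j := by
    refine forall_congr' fun i => forall_congr' fun j => forall_congr' fun x => ?_
    rw [conformality_eq_angle g (hφ i) (hφ j) (hc i) (hc j) (h0 i x) (h0 j x), Matrix.of_apply,
      mul_left_inj' (mul_ne_zero (h0 i x) (h0 j x)), neg_inj, Complex.ofReal_inj]
  rw [IsEigenfamily, h1]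
  -- The Gram condition gives |∇θᵢ|² = Aᵢᵢ, which cancels the real part of the eigenvalue equation
  -- and leaves iΔθᵢ = 0.
  refine and_congr_right fun hg => forall_congr' fun i => forall_congr' fun x => ?_
  rw [laplaceBeltrami_eq_angle g (hφ i) (hc i) (h0 i x), mul_left_inj' (h0 i x), hg]
  rw [sub_eq_neg_self, mul_eq_zero, or_iff_left Complex.I_ne_zero, Complex.ofReal_eq_zero]

end Main

end

end EigenTorus

theorem theorem4p5 {m k : ℕ} {M : Type*} [TopologicalSpace M]
    [ChartedSpace (EuclideanSpace ℝ (Fin m)) M] [IsManifold (𝓡 m) ∞ M]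
    [T2Space M] [CompactSpace M] [ConnectedSpace M]
    (g : EigenTorus.SmoothMetric m M)
    (A : Matrix (Fin k) (Fin k) ℝ) (hA : A.IsSymm)
    (φ : Fin k → M → ℂ) (hφ : ∀ i, ContMDiff (𝓡 m) 𝓘(ℝ, ℂ) ∞ (φ i))
    (hφ0 : ∀ i, ∃ x, φ i x ≠ 0) :
    (EigenTorus.IsReducedEigenfamily g (fun i => -(A i i : ℂ))
        (Matrix.of fun i j => -(A i j : ℂ)) φ ↔
      ∃ hpos : A.PosDef, ∀ x₀ : M, (∀ i, φ i x₀ ≠ 0) ∧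
        ∃ π : M → EigenTorus.Torus k,
          (∀ x i, ((π x i : Circle) : ℂ) = φ i x / (‖φ i x₀‖ : ℂ)) ∧
          EigenTorus.IsHarmonicMap g (EigenTorus.Torus.flatMetric A hpos) π ∧
          EigenTorus.IsRiemannianSubmersion g (EigenTorus.Torus.flatMetric A hpos) π) ∧
    (EigenTorus.IsReducedEigenfamily g (fun i => -(A i i : ℂ))
        (Matrix.of fun i j => -(A i j : ℂ)) φ →
      ∀ x₀ : M, ∀ π : M → EigenTorus.Torus k,
        (∀ x i, ((π x i : Circle) : ℂ) = φ i x / (‖φ i x₀‖ : ℂ)) → Function.Surjective π) := by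
  open EigenTorus in
  have key : IsReducedEigenfamily g (fun i => -(A i i : ℂ))
        (Matrix.of fun i j => -(A i j : ℂ)) φ →
      ∃ hpos : A.PosDef, (∀ i p q, ‖φ i p‖ = ‖φ i q‖) ∧ (∀ i x, φ i x ≠ 0) ∧
        ∀ (x₀ : M) (π : M → Torus k), (∀ x i, ((π x i : Circle) : ℂ) = φ i x / (‖φ i x₀‖ : ℂ)) →
          IsHarmonicMap g (Torus.flatMetric A hpos) π ∧
          IsRiemannianSubmersion g (Torus.flatMetric A hpos) π := by
    rintro ⟨hE, hN⟩
    have hc := norm_eq_of_eigenfamily hφ hE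
    have h0 := ne_zero_of_norm_eq hφ0 hc
    obtain ⟨hgram, hlap⟩ := (isEigenfamily_iff_angle g hφ hc h0).1 hE
    obtain ⟨p⟩ : Nonempty M := inferInstance
    -- A is the Gram matrix of the angle gradients at any single point.
    have hpsd : A.PosSemidef := by
      have h1 := posSemidef_gram g p fun i => angle (φ i) p
      simp only [hgram] at h1
      exact h1
    have hpos : A.PosDef :=
      hpsd.posDef_iff_det_ne_zero.2 (nondegenerate_neg_ofReal_iff.1 hN)
    refine ⟨hpos, hc, h0, fun x₀ π hπ => ?_⟩
    have hs := contMDiff_angleMap hφ hπ h0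
    refine ⟨⟨hs, fun x c => ?_⟩, (isRiemannianSubmersion_iff g hpos hs).2 fun x => ?_⟩
    · rw [tensionField_angleMap g hpos hπ h0, hlap]
    · ext i j
      rw [gram_angleMap g hπ h0, hgram]
  refine ⟨⟨fun h => ?_, ?_⟩, fun h x₀ π hπ => ?_⟩
  · obtain ⟨hpos, hc, h0, hπ⟩ := key h
    refine ⟨hpos, fun x₀ => ⟨fun i => h0 i x₀, ?_⟩⟩
    obtain ⟨π, hπ0⟩ := EigenTorus.exists_angleMap hc h0 x₀
    exact ⟨π, hπ0, hπ x₀ π hπ0⟩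
  · rintro ⟨hpos, h⟩
    have h0 : ∀ i x, φ i x ≠ 0 := fun i x => (h x).1 i
    obtain ⟨x₀⟩ : Nonempty M := inferInstance
    obtain ⟨-, π, hπ, hharm, hsub⟩ := h x₀
    -- The components of π have modulus 1, which forces |φᵢ| to equal its value at the one chosen
    -- base point.
    have hc' : ∀ i p, ‖φ i p‖ = ‖φ i x₀‖ := fun i p => by
      have h1 := congrArg norm (hπ p i)
      rw [Circle.norm_coe, norm_div, Complex.norm_real, norm_norm] at h1
      exact ((div_eq_one_iff_eq (norm_ne_zero_iff.2 (h0 i x₀))).1 h1.symm)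
    have hc : ∀ i p q, ‖φ i p‖ = ‖φ i q‖ := fun i p q => (hc' i p).trans (hc' i q).symm
    refine ⟨(EigenTorus.isEigenfamily_iff_angle g hφ hc h0).2 ⟨fun i j x => ?_, fun i x => ?_⟩,
      EigenTorus.nondegenerate_neg_ofReal_iff.2 hpos.det_pos.ne'⟩
    · rw [← EigenTorus.gram_angleMap g hπ h0,
        (EigenTorus.isRiemannianSubmersion_iff g hpos hsub.contMDiff).1 hsub x]
    · rw [← EigenTorus.tensionField_angleMap g hpos hπ h0, hharm.2]
  · obtain ⟨hpos, hc, h0, h1⟩ := key h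
    have hsub := (h1 x₀ π hπ).2
    exact EigenTorus.surjective_of_surjective_mfderiv hsub.contMDiff hsub.surjective_mfderiv
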